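/- Theorem 3.4. Let $n\ge 0$ and let $X$ be a finite multiset of nonzero vectors of $\mathbb{R}^n$ that spans $\mathbb{R}^n$. For $x\in\mathbb{R}^n$ let $p_x=\sum_j x_jt_j\in\Pi:=\mathbb{C}[t_1,\dots,t_n]$, and for a multiset $Y$ let $p_Y=\prod_{y\in Y}p_y$. For a sub-multiset $X'\subseteq X$ let $$\mathcal{P}(X')=\operatorname{span}_{\mathbb{C}}\{p_Y:\ Y\subseteq X',\ \operatorname{rank}(X'\setminus Y)=n\}.$$ A facet hyperplane of $X$ is a subspace $F$ of dimension $n-1$ spanned by members of $X$; let $m(F)=\#\{x\in X: x\notin F\}$ (with multiplicity), and let $\eta_F\neq 0$ denote any vector orthogonal to $F$. Let $\mathcal{I}(X)$ be the ideal of $\Pi$ generated by the polynomials $p_{\eta_F}^{m(F)}$ over all facet hyperplanes $F$ of $X$. For an ideal $J\subseteq\Pi$ let $\ker J=\{q\in\Pi:\ p(D)q=0\text{ for all }p\in J\}$, where $p(D)=p(\partial/\partial t_1,\dots,\partial/\partial t_n)$. Let $I\subseteq X$ be a linearly independent sub-multiset. Let $\mathcal{P}_-(X,I)=\bigcap_{b\in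 I}\mathcal{P}(X\setminus b)$, where the intersection is taken inside $\mathcal{P}(X)$, so that $\mathcal{P}_-(X,\emptyset)=\mathcal{P}(X)$. Let $\mathcal{I}_-(X,I)$ be the ideal generated by $\mathcal{I}(X)$ and the polynomials $p_{\eta_F}^{m(F)-1}$ over all facet hyperplanes $F$ of $X$ with $I\not\subseteq F$. Given a total order $\prec$ on $X$ with $x\prec y$ for all $x\in X\setminus I$ and $y\in I$, let $\mathbb{B}_-(X,I)$ be the set of those sub-multisets $B\subseteq X$ that are bases of $\mathbb{R}^n$ and have no element $b\in B\cap I$ with $b=\max\bigl(X\setminus\operatorname{span}(B\setminus b)\bigr)$. Then: 1. For every such order $\prec$, the space $\mathcal{P}_-(X,I)$ is finite-dimensional and $\dim\mathcal{P}_-(X,I)=\#\mathbb{B}_-(X,I)$. 2. $\mathcal{P}_-(X,I)=\ker\mathcal{I}_-(X,I)$. 3. $\mathcal{P}_-(X,I)$ depends only on $\operatorname{span} I$: if $I'\subseteq X$ is another linearly independent sub-multiset with $\operatorname{span}I'=\operatorname{span}I$, then $\mathcal{P}_-(X,I')=\mathcal{P}_-(X,I)$. -/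

import Mathlib

namespace Zonotopal

noncomputable section

/-- The linear form `p_x = x₁ t₁ + ⋯ + xₙ tₙ` in `ℂ[t₁, …, tₙ]` given by a real vector `x`. -/
def linForm {n : ℕ} (x : Fin n → ℝ) : MvPolynomial (Fin n) ℂ :=
  ∑ j, MvPolynomial.C (x j : ℂ) * MvPolynomial.X j

/-- The monomial differential operator `∂^m = ∂₁^{m₁} ⋯ ∂ₙ^{mₙ}`. -/
def monomialDiff {n : ℕ} (m : Fin n →₀ ℕ) : Module.End ℂ (MvPolynomial (Fin n) ℂ) :=
  (List.ofFn fun j : Fin n =>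
    ((MvPolynomial.pderiv j).toLinearMap : Module.End ℂ (MvPolynomial (Fin n) ℂ)) ^ m j).prod

/-- The differential operator `p(D) = p(∂₁, …, ∂ₙ)`. -/
def polyDiff {n : ℕ} (p : MvPolynomial (Fin n) ℂ) : Module.End ℂ (MvPolynomial (Fin n) ℂ) :=
  ∑ m ∈ p.support, p.coeff m • monomialDiff m

/-- The kernel of an ideal `J`: all `q` with `p(D) q = 0` for every `p ∈ J`. -/
def idealKer {n : ℕ} (J : Ideal (MvPolynomial (Fin n) ℂ)) :
    Submodule ℂ (MvPolynomial (Fin n) ℂ) where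
  carrier := {q | ∀ p ∈ J, polyDiff p q = 0}
  zero_mem' := fun p _ => map_zero (polyDiff p)
  add_mem' := fun {a b} ha hb p hp => by rw [map_add, ha p hp, hb p hp, add_zero]
  smul_mem' := fun c a ha p hp => by rw [map_smul, ha p hp, smul_zero]

/-- The central space `𝒫(X)`: the span of the products `p_Y = ∏_{y ∈ Y} p_y` over the short
sub-multisets `Y` of `X`, those for which `X ∖ Y` still has rank `n`. The multiset `X` of vectors
of `ℝⁿ` is an indexed family, so that its sub-multisets are the sets of indices. -/
def centralSpace {n : ℕ} {ι : Type*} (X : ι → Fin n → ℝ) :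
    Submodule ℂ (MvPolynomial (Fin n) ℂ) :=
  Submodule.span ℂ {p | ∃ Y : Finset ι,
    Submodule.span ℝ (X '' (Y : Set ι)ᶜ) = ⊤ ∧ p = ∏ y ∈ Y, linForm (X y)}

/-- The family `X ∖ b`, with the member of index `b` removed. -/
def deletion {n : ℕ} {ι : Type*} (X : ι → Fin n → ℝ) (b : ι) : {i : ι // i ≠ b} → Fin n → ℝ :=
  fun i => X i

/-- `𝒫₋(X, I)`, the intersection of the spaces `𝒫(X ∖ b)`, `b ∈ I`. As all of these lie in
`𝒫(X)`, the intersection is formed inside `𝒫(X)`; this only matters for `I = ∅`, where the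
empty intersection is then `𝒫(X)`. -/
def semiInternalSpace {n : ℕ} {ι : Type*} (X : ι → Fin n → ℝ) (I : Set ι) :
    Submodule ℂ (MvPolynomial (Fin n) ℂ) :=
  centralSpace X ⊓ ⨅ b ∈ I, centralSpace (deletion X b)

theorem centralSpace_deletion_le {n : ℕ} {ι : Type*} (X : ι → Fin n → ℝ) (b : ι) :
    centralSpace (deletion X b) ≤ centralSpace X := by
  refine Submodule.span_mono ?_
  rintro p ⟨Y, hY, rfl⟩
  refine ⟨Y.map (Function.Embedding.subtype _), ?_, ?_⟩
  · rw [eq_top_iff, ← hY]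
    refine Submodule.span_mono ?_
    rintro v ⟨i, hi, rfl⟩
    refine ⟨i, ?_, rfl⟩
    intro h
    apply hi
    obtain ⟨_, h⟩ : i.1 ≠ b ∧ i ∈ Y := by simpa using h
    exact h
  · rw [Finset.prod_map]
    rfl

/-- For nonempty `I`, the space `𝒫₋(X, I)` is the plain intersection of the `𝒫(X ∖ b)`. -/
theorem semiInternalSpace_eq_iInf {n : ℕ} {ι : Type*} (X : ι → Fin n → ℝ) (I : Set ι)
    (hI : I.Nonempty) :
    semiInternalSpace X I = ⨅ b ∈ I, centralSpace (deletion X b) := by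
  obtain ⟨b, hb⟩ := hI
  exact inf_eq_right.mpr ((iInf₂_le b hb).trans (centralSpace_deletion_le X b))

/-- `F` is a facet hyperplane of `X`: a subspace of dimension `n - 1` spanned by members of `X`. -/
def IsFacet {n : ℕ} {ι : Type*} (X : ι → Fin n → ℝ) (F : Submodule ℝ (Fin n → ℝ)) : Prop :=
  Module.finrank ℝ F + 1 = n ∧ ∃ Y : Set ι, Submodule.span ℝ (X '' Y) = F

/-- The multiplicity `m(F)`: the number of members of `X` outside `F`. -/
def facetMult {n : ℕ} {ι : Type*} (X : ι → Fin n → ℝ) (F : Submodule ℝ (Fin n → ℝ)) : ℕ :=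
  {i : ι | X i ∉ F}.ncard

/-- `η` is a normal of `F`: a nonzero vector orthogonal to `F`. -/
def IsNormalTo {n : ℕ} (η : Fin n → ℝ) (F : Submodule ℝ (Fin n → ℝ)) : Prop :=
  η ≠ 0 ∧ ∀ v ∈ F, η ⬝ᵥ v = 0

/-- The central ideal `ℐ(X)`, generated by the powers `p_{η_F}^{m(F)}` over all facet
hyperplanes `F` of `X`. -/
def centralIdeal {n : ℕ} {ι : Type*} (X : ι → Fin n → ℝ) : Ideal (MvPolynomial (Fin n) ℂ) :=
  Ideal.span {p | ∃ F η, IsFacet X F ∧ IsNormalTo η F ∧ p = linForm η ^ facetMult X F}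

/-- The ideal `ℐ₋(X, I)`, generated by `ℐ(X)` and the powers `p_{η_F}^{m(F) - 1}` over the facet
hyperplanes `F` of `X` that do not contain `I`. When `X` spans `ℝⁿ`, every facet hyperplane has
`m(F) ≥ 1`, and the subtraction is a true one. -/
def semiInternalIdeal {n : ℕ} {ι : Type*} (X : ι → Fin n → ℝ) (I : Set ι) :
    Ideal (MvPolynomial (Fin n) ℂ) :=
  Ideal.span ((centralIdeal X : Set (MvPolynomial (Fin n) ℂ)) ∪
    {p | ∃ F η, IsFacet X F ∧ ¬ (X '' I ⊆ (F : Set (Fin n → ℝ))) ∧ IsNormalTo η F ∧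
      p = linForm η ^ (facetMult X F - 1)})

/-- `𝔹(X)`: the sub-multisets `B` of `X` that are bases of `ℝⁿ`. -/
def bases {n : ℕ} {ι : Type*} (X : ι → Fin n → ℝ) : Set (Set ι) :=
  {B | LinearIndepOn ℝ X B ∧ Submodule.span ℝ (X '' B) = ⊤}

/-- `b` is `I`-internally active in `B`: `b ∈ B` lies in `I` and is the last member of `X`
outside the span of `B ∖ b`. -/
def IsInternallyActive {n : ℕ} {ι : Type*} [LinearOrder ι] (X : ι → Fin n → ℝ) (I B : Set ι)
    (b : ι) : Prop :=
  b ∈ B ∧ b ∈ I ∧ IsGreatest {i | X i ∉ Submodule.span ℝ (X '' (B \ {b}))} b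

/-- `𝔹₋(X, I)`: the `I`-internal bases, those without an `I`-internally active member. -/
def internalBases {n : ℕ} {ι : Type*} [LinearOrder ι] (X : ι → Fin n → ℝ) (I : Set ι) :
    Set (Set ι) :=
  {B | B ∈ bases X ∧ ∀ b, ¬ IsInternallyActive X I B b}

end

end Zonotopal

/-! Both descriptions of the space are compared with a third, `facetKer X I`: the polynomials killed
by `D_f ^ e(f)` for every functional `f` whose kernel is a facet hyperplane, where `e(f)` is `m(ker
f)`, less one if `I ⊄ ker f`. Since `p_η(D)` is the derivative along `η`, this is the kernel of the
ideal (`facetKer_eq_idealKer`), and its exponents see `I` only through `span I`, whence the third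
claim.

Upper bound (`finrank_facetKer_le`), by induction on the size of `X`: let `x` be its first member.
Setting `p_x = 0` maps `facetKer X I` into the facet kernel of the contraction `X/x`, and a multiple
`p_x q` in it has `q` in the facet kernel of `X ∖ x`. In parallel, the internal bases of `X/x`, with
`x` adjoined, and those of `X ∖ x` are distinct internal bases of `X`.

The same splitting bounds `dim 𝒫(X)` below by the number of bases (`ncard_bases_le_finrank`), and
`𝒫(X) ⊆ facetKer X ∅` because a short product has fewer than `m(ker f)` factors not constant along
`f`. So the two agree; applied to each `X ∖ b`, this yields `semiInternalSpace X I = facetKer X I`.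

Lower bound (`ncard_internalBases_le_finrank`), by induction on the size of `I`: let `a` be the
first element of `I`. Passing from `I ∖ a` to `I` lowers the exponent only at facets `F` that
contain `I ∖ a` but not `a`. At such `F`, the operator `D_F ^ (m(F) - 1)` sends `𝒫₋(X, I ∖ a)` into
`𝒫₋(X ∩ F, I ∖ a)`, so its rank is at most the number of internal bases of `X ∩ F`. Adjoining `a`
makes these members of `𝔹₋(X, I ∖ a)` in which `a` is active, as all that follows `a` lies in `I ∖ a
⊆ F`. They are distinct for distinct `F` and none is in `𝔹₋(X, I)`, so the dimension drops by no
more than the count does. -/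

namespace Zonotopal

open MvPolynomial

/-! ### Directional derivatives of products of linear forms -/

/-- The derivative of polynomials in the direction of a linear functional `f`: the derivation
that sends each `p_v` to the constant `f v`. -/
noncomputable def dirDiff {n : ℕ} (f : (Fin n → ℝ) →ₗ[ℝ] ℝ) :
    Module.End ℂ (MvPolynomial (Fin n) ℂ) :=
  (mkDerivation ℂ fun j => C (f (Pi.single j 1) : ℂ) :
    Derivation ℂ (MvPolynomial (Fin n) ℂ) (MvPolynomial (Fin n) ℂ)).toLinearMap

theorem dirDiff_mul {n : ℕ} (f : (Fin n → ℝ) →ₗ[ℝ] ℝ) (p q : MvPolynomial (Fin n) ℂ) :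
    dirDiff f (p * q) = p * dirDiff f q + q * dirDiff f p := by
  simp [dirDiff, Derivation.leibniz]

theorem dirDiff_C {n : ℕ} (f : (Fin n → ℝ) →ₗ[ℝ] ℝ) (c : ℂ) : dirDiff f (C c) = 0 := by
  simp [dirDiff]

theorem dirDiff_X {n : ℕ} (f : (Fin n → ℝ) →ₗ[ℝ] ℝ) (j : Fin n) :
    dirDiff f (X j) = C (f (Pi.single j 1) : ℂ) := by
  simp [dirDiff, mkDerivation_X]

theorem linForm_single {n : ℕ} (j : Fin n) : linForm (Pi.single j (1 : ℝ)) = X j := by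
  rw [linForm, Finset.sum_eq_single j]
  · simp
  · intro b _ hb
    simp [Pi.single_eq_of_ne hb]
  · simp

theorem dirDiff_linForm {n : ℕ} (f : (Fin n → ℝ) →ₗ[ℝ] ℝ) (v : Fin n → ℝ) :
    dirDiff f (linForm v) = C (f v : ℂ) := by
  rw [LinearMap.pi_apply_eq_sum_univ f v, linForm, map_sum]
  simp only [dirDiff_mul, dirDiff_C, dirDiff_X, mul_zero, add_zero, smul_eq_mul]
  push_cast
  rw [map_sum]
  refine Finset.sum_congr rfl fun j _ => ?_
  rw [map_mul]
  congr 3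
  norm_cast
  congr 1
  ext i
  simp [Pi.single_apply, eq_comm]

theorem dirDiff_smul {n : ℕ} (c : ℝ) (f : (Fin n → ℝ) →ₗ[ℝ] ℝ) :
    dirDiff (c • f) = (c : ℂ) • dirDiff f := by
  refine LinearMap.ext fun q => ?_
  induction q using MvPolynomial.induction_on with
  | C a => simp [dirDiff_C]
  | add p q hp hq => rw [map_add, hp, hq, map_add]
  | mul_X p j hp =>
    rw [dirDiff_mul, hp, LinearMap.smul_apply, LinearMap.smul_apply, dirDiff_mul, dirDiff_X,
      dirDiff_X]
    simp [smul_eq_C_mul]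
    ring

theorem dirDiff_pow_succ_linForm_mul {n : ℕ} (f : (Fin n → ℝ) →ₗ[ℝ] ℝ) (v : Fin n → ℝ) (m : ℕ)
    (q : MvPolynomial (Fin n) ℂ) :
    (dirDiff f ^ (m + 1)) (linForm v * q) =
      linForm v * (dirDiff f ^ (m + 1)) q + ((m + 1) * (f v : ℂ)) • (dirDiff f ^ m) q := by
  induction m with
  | zero =>
    simp only [zero_add, pow_one, pow_zero, dirDiff_mul, dirDiff_linForm, smul_eq_C_mul,
      Nat.cast_zero, one_mul, Module.End.one_apply]
    ring
  | succ m ih =>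
    rw [pow_succ', Module.End.mul_apply, ih, map_add, map_smul, dirDiff_mul, dirDiff_linForm,
      ← Module.End.mul_apply, ← Module.End.mul_apply, ← pow_succ', ← pow_succ']
    simp only [smul_eq_C_mul]
    push_cast
    simp only [map_mul, map_add, map_one]
    ring

theorem dirDiff_pow_linForm_mul_of_eq_zero {n : ℕ} {f : (Fin n → ℝ) →ₗ[ℝ] ℝ} {v : Fin n → ℝ}
    (hv : f v = 0) (m : ℕ) (q : MvPolynomial (Fin n) ℂ) :
    (dirDiff f ^ m) (linForm v * q) = linForm v * (dirDiff f ^ m) q := by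
  cases m with
  | zero => simp
  | succ m => rw [dirDiff_pow_succ_linForm_mul]; simp [hv]

theorem dirDiff_pow_eq_zero_of_le {n : ℕ} {f : (Fin n → ℝ) →ₗ[ℝ] ℝ} {a b : ℕ} (hab : a ≤ b)
    {q : MvPolynomial (Fin n) ℂ} (h : (dirDiff f ^ a) q = 0) : (dirDiff f ^ b) q = 0 := by
  obtain ⟨c, rfl⟩ := Nat.exists_eq_add_of_le' hab
  rw [pow_add, Module.End.mul_apply, h, map_zero]

theorem exists_dirDiff_pow_eq_zero {n : ℕ} (f : (Fin n → ℝ) →ₗ[ℝ] ℝ)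
    (q : MvPolynomial (Fin n) ℂ) : ∃ s, (dirDiff f ^ s) q = 0 := by
  induction q using MvPolynomial.induction_on with
  | C a => exact ⟨1, by simp [dirDiff_C]⟩
  | add p q hp hq =>
    obtain ⟨s, hs⟩ := hp
    obtain ⟨t, ht⟩ := hq
    refine ⟨max s t, ?_⟩
    rw [map_add, dirDiff_pow_eq_zero_of_le (le_max_left s t) hs,
      dirDiff_pow_eq_zero_of_le (le_max_right s t) ht, add_zero]
  | mul_X p j hp =>
    obtain ⟨s, hs⟩ := hp
    refine ⟨s + 1, ?_⟩
    rw [mul_comm, ← linForm_single, dirDiff_pow_succ_linForm_mul, hs,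
      dirDiff_pow_eq_zero_of_le (Nat.le_succ s) hs, mul_zero, smul_zero, add_zero]

theorem linForm_ne_zero {n : ℕ} {v : Fin n → ℝ} (hv : v ≠ 0) : linForm v ≠ 0 := by
  obtain ⟨j, hj⟩ := Function.ne_iff.mp hv
  intro h
  have := dirDiff_linForm (LinearMap.proj j) v
  rw [h, map_zero, eq_comm, map_eq_zero_iff _ (C_injective _ _)] at this
  exact hj (by simpa using this)

/-- A factor `p_v` that is not constant along `f` accounts for one order of vanishing. -/
theorem dirDiff_pow_pred_eq_zero {n : ℕ} {f : (Fin n → ℝ) →ₗ[ℝ] ℝ} {v : Fin n → ℝ}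
    (hv : f v ≠ 0) {m : ℕ} {q : MvPolynomial (Fin n) ℂ}
    (h : (dirDiff f ^ m) (linForm v * q) = 0) : (dirDiff f ^ (m - 1)) q = 0 := by
  have hv0 : v ≠ 0 := by rintro rfl; simp at hv
  cases m with
  | zero =>
    -- Here `m - 1` is again `0`, and the claim is `q = 0`.
    have : linForm v * q = 0 := by simpa using h
    simpa [linForm_ne_zero hv0] using this
  | succ m =>
    -- Some power `s` kills `q`. While it exceeds `m`, the Leibniz formula leaves only a nonzero
    -- multiple of the next lower derivative of `q`, so `s` descends to `m`.
    obtain ⟨s, hs⟩ := exists_dirDiff_pow_eq_zero f q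
    rcases le_total s m with hsm | hsm
    · exact dirDiff_pow_eq_zero_of_le hsm hs
    rw [Nat.add_sub_cancel]
    induction s, hsm using Nat.le_induction with
    | base => exact hs
    | succ s hsm ih =>
      refine ih ?_
      have h2 := dirDiff_pow_eq_zero_of_le (Nat.succ_le_succ hsm) h
      rw [dirDiff_pow_succ_linForm_mul, hs, mul_zero, zero_add, smul_eq_zero] at h2
      refine h2.resolve_left (mul_ne_zero (by norm_cast) (by exact_mod_cast hv))

theorem exists_dirDiff_pow_card_prod {n : ℕ} {ι : Type*} (f : (Fin n → ℝ) →ₗ[ℝ] ℝ)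
    (X : ι → Fin n → ℝ) (Y : Finset ι) :
    ∃ c : ℂ, (dirDiff f ^ Y.card) (∏ y ∈ Y, linForm (X y)) = C c := by
  classical
  induction Y using Finset.induction_on with
  | empty => exact ⟨1, by simp⟩
  | insert a Y ha ih =>
    obtain ⟨c, hc⟩ := ih
    rw [Finset.card_insert_of_notMem ha, Finset.prod_insert ha, dirDiff_pow_succ_linForm_mul,
      pow_succ', Module.End.mul_apply, hc, dirDiff_C, smul_eq_C_mul, mul_zero, zero_add, ← map_mul]
    exact ⟨_, rfl⟩

theorem dirDiff_pow_prod_mul {n : ℕ} {ι : Type*} (f : (Fin n → ℝ) →ₗ[ℝ] ℝ)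
    (X : ι → Fin n → ℝ) (Y : Finset ι) (hY : ∀ y ∈ Y, f (X y) = 0) (m : ℕ)
    (q : MvPolynomial (Fin n) ℂ) :
    (dirDiff f ^ m) ((∏ y ∈ Y, linForm (X y)) * q) =
      (∏ y ∈ Y, linForm (X y)) * (dirDiff f ^ m) q := by
  classical
  induction Y using Finset.induction_on with
  | empty => simp
  | insert a Y ha ih =>
    rw [Finset.prod_insert ha, mul_assoc,
      dirDiff_pow_linForm_mul_of_eq_zero (hY a (Finset.mem_insert_self a Y)),
      ih fun y hy => hY y (Finset.mem_insert_of_mem hy), mul_assoc]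

open Classical in
theorem exists_dirDiff_pow_prod {n : ℕ} {ι : Type*} (f : (Fin n → ℝ) →ₗ[ℝ] ℝ)
    (X : ι → Fin n → ℝ) (Y : Finset ι) :
    ∃ c : ℂ, (dirDiff f ^ (Y.filter fun y => f (X y) ≠ 0).card) (∏ y ∈ Y, linForm (X y)) =
      c • ∏ y ∈ Y with f (X y) = 0, linForm (X y) := by
  obtain ⟨c, hc⟩ := exists_dirDiff_pow_card_prod f X (Y.filter fun y => f (X y) ≠ 0)
  refine ⟨c, ?_⟩
  rw [← Finset.prod_filter_mul_prod_filter_not Y (fun y => f (X y) = 0),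
    dirDiff_pow_prod_mul _ _ _ (by simp), hc, smul_eq_C_mul, mul_comm]

open Classical in
theorem dirDiff_pow_prod_eq_zero {n : ℕ} {ι : Type*} (f : (Fin n → ℝ) →ₗ[ℝ] ℝ)
    (X : ι → Fin n → ℝ) (Y : Finset ι) {m : ℕ}
    (hm : (Y.filter fun y => f (X y) ≠ 0).card < m) :
    (dirDiff f ^ m) (∏ y ∈ Y, linForm (X y)) = 0 := by
  obtain ⟨c, hc⟩ := exists_dirDiff_pow_card_prod f X (Y.filter fun y => f (X y) ≠ 0)
  rw [← Finset.prod_filter_mul_prod_filter_not Y (fun y => f (X y) = 0),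
    dirDiff_pow_prod_mul _ _ _ (by simp),
    dirDiff_pow_eq_zero_of_le hm (by
      rw [Nat.succ_eq_add_one, pow_succ', Module.End.mul_apply, hc, dirDiff_C]), mul_zero]

/-! ### Polynomials under linear maps -/

/-- The algebra homomorphism with `p_v ↦ p_{g v}` given by a linear map `g`. -/
noncomputable def polyMap {n k : ℕ} (g : (Fin n → ℝ) →ₗ[ℝ] (Fin k → ℝ)) :
    MvPolynomial (Fin n) ℂ →ₐ[ℂ] MvPolynomial (Fin k) ℂ :=
  aeval fun j => linForm (g (Pi.single j 1))

theorem linForm_add {n : ℕ} (v w : Fin n → ℝ) : linForm (v + w) = linForm v + linForm w := by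
  simp [linForm, add_mul, Finset.sum_add_distrib]

theorem linForm_smul {n : ℕ} (c : ℝ) (v : Fin n → ℝ) :
    linForm (c • v) = (c : ℂ) • linForm v := by
  simp [linForm, Finset.smul_sum, smul_eq_C_mul, mul_assoc]

theorem linForm_sum {n : ℕ} {ι : Type*} (s : Finset ι) (v : ι → Fin n → ℝ) :
    linForm (∑ i ∈ s, v i) = ∑ i ∈ s, linForm (v i) := by
  classical
  induction s using Finset.induction_on with
  | empty => simp [linForm]
  | insert a s ha ih => rw [Finset.sum_insert ha, Finset.sum_insert ha, linForm_add, ih]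

theorem polyMap_linForm {n k : ℕ} (g : (Fin n → ℝ) →ₗ[ℝ] (Fin k → ℝ)) (v : Fin n → ℝ) :
    polyMap g (linForm v) = linForm (g v) := by
  conv_rhs => rw [pi_eq_sum_univ' v]
  rw [map_sum, linForm_sum, linForm, map_sum]
  refine Finset.sum_congr rfl fun j _ => ?_
  rw [map_smul, linForm_smul, smul_eq_C_mul, map_mul, polyMap, aeval_X]
  simp only [algHom_C, algebraMap_eq]

theorem polyMap_prod {n k : ℕ} {ι : Type*} (g : (Fin n → ℝ) →ₗ[ℝ] (Fin k → ℝ))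
    (X : ι → Fin n → ℝ) (Y : Finset ι) :
    polyMap g (∏ y ∈ Y, linForm (X y)) = ∏ y ∈ Y, linForm (g (X y)) := by
  simp [map_prod, polyMap_linForm]

theorem polyMap_X {n k : ℕ} (g : (Fin n → ℝ) →ₗ[ℝ] (Fin k → ℝ)) (j : Fin n) :
    polyMap g (X j) = linForm (g (Pi.single j 1)) := by
  simp [polyMap]

/-- If `σ` is a section of `φ` and `ker φ` is spanned by `x`, then `p_x` generates the kernel
of the algebra homomorphism of `φ`. -/
theorem linForm_dvd_of_polyMap_eq_zero {n k : ℕ} {φ : (Fin n → ℝ) →ₗ[ℝ] (Fin k → ℝ)}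
    {σ : (Fin k → ℝ) →ₗ[ℝ] (Fin n → ℝ)} (hσ : ∀ v, φ (σ v) = v) {x : Fin n → ℝ}
    (hφ : LinearMap.ker φ = Submodule.span ℝ {x}) {q : MvPolynomial (Fin n) ℂ}
    (hq : polyMap φ q = 0) : linForm x ∣ q := by
  -- Modulo `p_x` the composite `σ ∘ φ` acts as the identity: on variables because `v - σ (φ v)`
  -- lies in `ker φ`, hence on all polynomials.
  have key : ∀ q, linForm x ∣ q - polyMap σ (polyMap φ q) := by
    intro q
    induction q using MvPolynomial.induction_on with
    | C a => simp [algHom_C]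
    | add p q hp hq =>
      rw [map_add, map_add, add_sub_add_comm]
      exact dvd_add hp hq
    | mul_X p j hp =>
      have h1 : Pi.single j (1 : ℝ) - σ (φ (Pi.single j 1)) ∈ Submodule.span ℝ {x} := by
        rw [← hφ, LinearMap.mem_ker, map_sub, hσ, sub_self]
      obtain ⟨c, hc⟩ := Submodule.mem_span_singleton.mp h1
      have h2 : linForm x ∣ X j - polyMap σ (polyMap φ (X j)) := by
        rw [polyMap_X, polyMap_linForm, ← linForm_single, sub_eq_add_neg, ← neg_one_smul ℂ]
        have := linForm_smul (-1) (σ (φ (Pi.single j 1)))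
        push_cast at this
        rw [← this, ← linForm_add, neg_one_smul, ← sub_eq_add_neg, ← hc, linForm_smul]
        exact dvd_smul_of_dvd _ dvd_rfl
      rw [map_mul, map_mul, show p * X j - polyMap σ (polyMap φ p) * polyMap σ (polyMap φ (X j)) =
        (p - polyMap σ (polyMap φ p)) * X j +
          polyMap σ (polyMap φ p) * (X j - polyMap σ (polyMap φ (X j))) by ring]
      exact dvd_add (hp.mul_right _) (h2.mul_left _)
  simpa [hq] using key q

theorem polyMap_injective {n k : ℕ} {ψ : (Fin k → ℝ) →ₗ[ℝ] (Fin n → ℝ)}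
    {ρ : (Fin n → ℝ) →ₗ[ℝ] (Fin k → ℝ)} (hρ : ∀ v, ρ (ψ v) = v) :
    Function.Injective (polyMap ψ) := by
  have : (polyMap ρ).comp (polyMap ψ) = AlgHom.id ℂ _ := by
    refine MvPolynomial.algHom_ext fun j => ?_
    rw [AlgHom.comp_apply, polyMap_X, polyMap_linForm, hρ, linForm_single, AlgHom.id_apply]
  exact Function.LeftInverse.injective (g := polyMap ρ) fun q => DFunLike.congr_fun this q

theorem polyMap_dirDiff {n k : ℕ} (φ : (Fin n → ℝ) →ₗ[ℝ] (Fin k → ℝ))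
    (f : (Fin k → ℝ) →ₗ[ℝ] ℝ) (q : MvPolynomial (Fin n) ℂ) :
    polyMap φ (dirDiff (f ∘ₗ φ) q) = dirDiff f (polyMap φ q) := by
  induction q using MvPolynomial.induction_on with
  | C a => simp [dirDiff_C, algHom_C]
  | add p q hp hq => rw [map_add, map_add, hp, hq, map_add, map_add]
  | mul_X p j hp =>
    rw [dirDiff_mul, map_add, map_mul, map_mul, map_mul, hp, dirDiff_mul, dirDiff_X, polyMap_X,
      dirDiff_linForm]
    simp [algHom_C]

theorem polyMap_dirDiff_pow {n k : ℕ} (φ : (Fin n → ℝ) →ₗ[ℝ] (Fin k → ℝ))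
    (f : (Fin k → ℝ) →ₗ[ℝ] ℝ) (m : ℕ) (q : MvPolynomial (Fin n) ℂ) :
    polyMap φ ((dirDiff (f ∘ₗ φ) ^ m) q) = (dirDiff f ^ m) (polyMap φ q) := by
  induction m with
  | zero => simp
  | succ m ih =>
    rw [pow_succ', Module.End.mul_apply, polyMap_dirDiff, ih, pow_succ', Module.End.mul_apply]

/-- Surjections `ℝᵏ⁺¹ → ℝᵏ` with a given one-dimensional kernel, with a section. -/
theorem exists_contraction {k : ℕ} {v : Fin (k + 1) → ℝ} (hv : v ≠ 0) :
    ∃ (φ : (Fin (k + 1) → ℝ) →ₗ[ℝ] (Fin k → ℝ)) (σ : (Fin k → ℝ) →ₗ[ℝ] (Fin (k + 1) → ℝ)),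
      (∀ w, φ (σ w) = w) ∧ LinearMap.ker φ = Submodule.span ℝ {v} := by
  have h1 : Module.finrank ℝ ((Fin (k + 1) → ℝ) ⧸ Submodule.span ℝ {v}) =
      Module.finrank ℝ (Fin k → ℝ) := by
    have := Submodule.finrank_quotient_add_finrank (Submodule.span ℝ {v})
    rw [finrank_span_singleton hv, Module.finrank_fin_fun] at this
    rw [Module.finrank_fin_fun]
    omega
  let e := LinearEquiv.ofFinrankEq _ _ h1
  let φ : (Fin (k + 1) → ℝ) →ₗ[ℝ] (Fin k → ℝ) := e.toLinearMap ∘ₗ Submodule.mkQ _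
  obtain ⟨σ, hσ⟩ := LinearMap.exists_rightInverse_of_surjective φ
    (LinearMap.range_eq_top.mpr (e.surjective.comp (Submodule.mkQ_surjective _)))
  refine ⟨φ, σ, fun w => DFunLike.congr_fun hσ w, ?_⟩
  rw [LinearEquiv.ker_comp, Submodule.ker_mkQ]

/-- Parametrizations of a hyperplane `ker f` of `ℝᵏ⁺¹` by `ℝᵏ`, with a retraction. -/
theorem exists_hyperplane_param {k : ℕ} {f : (Fin (k + 1) → ℝ) →ₗ[ℝ] ℝ} (hf : f ≠ 0) :
    ∃ (ψ : (Fin k → ℝ) →ₗ[ℝ] (Fin (k + 1) → ℝ)) (ρ : (Fin (k + 1) → ℝ) →ₗ[ℝ] (Fin k → ℝ)),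
      (∀ w, ρ (ψ w) = w) ∧ LinearMap.range ψ = LinearMap.ker f := by
  have h1 : Module.finrank ℝ (Fin k → ℝ) = Module.finrank ℝ (LinearMap.ker f) := by
    have := Module.Dual.finrank_ker_add_one_of_ne_zero (f := f) hf
    rw [Module.finrank_fin_fun] at this ⊢
    omega
  let e := LinearEquiv.ofFinrankEq _ _ h1
  let ψ : (Fin k → ℝ) →ₗ[ℝ] (Fin (k + 1) → ℝ) := (LinearMap.ker f).subtype ∘ₗ e.toLinearMap
  obtain ⟨ρ, hρ⟩ := LinearMap.exists_leftInverse_of_injective ψ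
    (LinearMap.ker_eq_bot.mpr (Subtype.val_injective.comp e.injective))
  refine ⟨ψ, ρ, fun w => DFunLike.congr_fun hρ w, ?_⟩
  rw [LinearMap.range_comp, LinearEquiv.range, Submodule.map_top, Submodule.range_subtype]

/-! ### Bases and internal bases under deletion and contraction -/

theorem mem_bases_iff {n : ℕ} {ι : Type*} [Finite ι] {X : ι → Fin n → ℝ} {B : Set ι} :
    B ∈ bases X ↔ Submodule.span ℝ (X '' B) = ⊤ ∧ B.ncard = n := by
  classical
  have := Fintype.ofFinite ι
  rw [bases, Set.mem_ofPred_eq, and_comm]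
  refine and_congr_right fun h => ?_
  rw [LinearIndepOn, linearIndependent_iff_card_eq_finrank_span, Set.finrank,
    ← Set.image_eq_range, h, finrank_top, Module.finrank_fin_fun, ← Nat.card_eq_fintype_card,
    Nat.card_coe_set_eq]

theorem notMem_span_of_mem_bases {n : ℕ} {ι : Type*} {X : ι → Fin n → ℝ} {B : Set ι}
    (hB : B ∈ bases X) {b : ι} (hb : b ∈ B) : X b ∉ Submodule.span ℝ (X '' (B \ {b})) := by
  rw [(hB.1.mono Set.sdiff_subset).notMem_span_iff, Set.insert_sdiff_singleton,
    Set.insert_eq_of_mem hb]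
  exact ⟨hB.1, by simp⟩

/-- The contraction of the family `X` at its member `x`: the images of the other members under a
linear map `φ`, of which `X x` is meant to span the kernel. -/
def contraction {n k : ℕ} {ι : Type*} (X : ι → Fin n → ℝ) (x : ι)
    (φ : (Fin n → ℝ) →ₗ[ℝ] (Fin k → ℝ)) : {i : ι // i ≠ x} → Fin k → ℝ :=
  fun i => φ (X i)

theorem deletion_image {n : ℕ} {ι : Type*} (X : ι → Fin n → ℝ) (x : ι) (S : Set {i : ι // i ≠ x}) :
    deletion X x '' S = X '' (Subtype.val '' S) := by
  rw [Set.image_image]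
  rfl

theorem mem_span_contraction {n k : ℕ} {ι : Type*} {X : ι → Fin n → ℝ} {x : ι}
    {φ : (Fin n → ℝ) →ₗ[ℝ] (Fin k → ℝ)} (hφ : LinearMap.ker φ = Submodule.span ℝ {X x})
    (S : Set {i : ι // i ≠ x}) (w : Fin n → ℝ) :
    φ w ∈ Submodule.span ℝ (contraction X x φ '' S) ↔
      w ∈ Submodule.span ℝ (X '' insert x (Subtype.val '' S)) := by
  have h : contraction X x φ '' S = φ '' (X '' (Subtype.val '' S)) := by
    rw [Set.image_image, Set.image_image]
    rfl
  rw [h, ← Submodule.map_span, ← Submodule.mem_comap, Submodule.comap_map_eq, hφ, sup_comm,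
    Set.image_insert_eq, Submodule.span_insert]

theorem span_contraction_eq_top {n k : ℕ} {ι : Type*} {X : ι → Fin n → ℝ} {x : ι}
    {φ : (Fin n → ℝ) →ₗ[ℝ] (Fin k → ℝ)} (hs : Function.Surjective φ)
    (hφ : LinearMap.ker φ = Submodule.span ℝ {X x}) (S : Set {i : ι // i ≠ x}) :
    Submodule.span ℝ (contraction X x φ '' S) = ⊤ ↔
      Submodule.span ℝ (X '' insert x (Subtype.val '' S)) = ⊤ := by
  rw [Submodule.eq_top_iff', Submodule.eq_top_iff', hs.forall]
  exact forall_congr' fun w => mem_span_contraction hφ S w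

theorem mem_bases_deletion {n : ℕ} {ι : Type*} [Finite ι] {X : ι → Fin n → ℝ} {x : ι}
    {B : Set {i : ι // i ≠ x}} : B ∈ bases (deletion X x) ↔ Subtype.val '' B ∈ bases X := by
  rw [mem_bases_iff, mem_bases_iff, deletion_image,
    Set.ncard_image_of_injective _ Subtype.val_injective]

theorem mem_bases_contraction {k : ℕ} {ι : Type*} [Finite ι] {X : ι → Fin (k + 1) → ℝ} {x : ι}
    {φ : (Fin (k + 1) → ℝ) →ₗ[ℝ] (Fin k → ℝ)} (hs : Function.Surjective φ)
    (hφ : LinearMap.ker φ = Submodule.span ℝ {X x}) {B : Set {i : ι // i ≠ x}} :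
    B ∈ bases (contraction X x φ) ↔ insert x (Subtype.val '' B) ∈ bases X := by
  rw [mem_bases_iff, mem_bases_iff, span_contraction_eq_top hs hφ,
    Set.ncard_insert_of_notMem (by simp), Set.ncard_image_of_injective _ Subtype.val_injective,
    Nat.add_right_cancel_iff]

theorem image_val_preimage_ne {ι : Type*} {x : ι} (B : Set ι) :
    (Subtype.val '' (Subtype.val ⁻¹' B : Set {i : ι // i ≠ x})) = B \ {x} := by
  ext i
  simp [and_comm]

/-- The deletion–contraction bound for the number of bases. -/
theorem ncard_bases_le {k : ℕ} {ι : Type*} [Finite ι] {X : ι → Fin (k + 1) → ℝ} {x : ι}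
    {φ : (Fin (k + 1) → ℝ) →ₗ[ℝ] (Fin k → ℝ)} (hs : Function.Surjective φ)
    (hφ : LinearMap.ker φ = Submodule.span ℝ {X x}) :
    (bases X).ncard ≤ (bases (contraction X x φ)).ncard + (bases (deletion X x)).ncard := by
  have h : bases X ⊆ (fun B => insert x (Subtype.val '' B)) '' bases (contraction X x φ) ∪
      (fun B => Subtype.val '' B) '' bases (deletion X x) := by
    intro B hB
    by_cases hx : x ∈ B
    · have : insert x (Subtype.val '' (Subtype.val ⁻¹' B : Set {i : ι // i ≠ x})) = B := by
        rw [image_val_preimage_ne, Set.insert_sdiff_singleton, Set.insert_eq_of_mem hx]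
      exact Or.inl ⟨_, (mem_bases_contraction hs hφ).mpr (this.symm ▸ hB), this⟩
    · have : (Subtype.val '' (Subtype.val ⁻¹' B : Set {i : ι // i ≠ x})) = B := by
        rw [image_val_preimage_ne, Set.sdiff_singleton_eq_self hx]
      exact Or.inr ⟨_, mem_bases_deletion.mpr (this.symm ▸ hB), this⟩
  exact (Set.ncard_le_ncard h).trans ((Set.ncard_union_le _ _).trans
    (add_le_add (Set.ncard_image_le) (Set.ncard_image_le)))

theorem ncard_bases_le_of_eq_zero {n : ℕ} {ι : Type*} [Finite ι] {X : ι → Fin n → ℝ} {x : ι}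
    (hx : X x = 0) : (bases X).ncard ≤ (bases (deletion X x)).ncard := by
  have h : bases X ⊆ (fun B => Subtype.val '' B) '' bases (deletion X x) := by
    intro B hB
    have hxB : x ∉ B := fun h => hB.1.ne_zero h hx
    have : (Subtype.val '' (Subtype.val ⁻¹' B : Set {i : ι // i ≠ x})) = B := by
      rw [image_val_preimage_ne, Set.sdiff_singleton_eq_self hxB]
    exact ⟨_, mem_bases_deletion.mpr (this.symm ▸ hB), this⟩
  exact (Set.ncard_le_ncard h).trans Set.ncard_image_le

/-- An element active in `X` stays active once `x` is deleted: it is still the last member outside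
the same span. -/
theorem image_val_mem_internalBases {n : ℕ} {ι : Type*} [Finite ι] [LinearOrder ι]
    {X : ι → Fin n → ℝ} {x : ι} {I : Set ι} {B : Set {i : ι // i ≠ x}}
    (hB : B ∈ internalBases (deletion X x) (Subtype.val ⁻¹' I)) :
    Subtype.val '' B ∈ internalBases X I := by
  refine ⟨mem_bases_deletion.mp hB.1, ?_⟩
  rintro _ ⟨⟨b, hb, rfl⟩, hbI, hmem, hmax⟩
  have h : ∀ i : {i : ι // i ≠ x}, i ∈ {i | deletion X x i ∉
      Submodule.span ℝ (deletion X x '' (B \ {b}))} ↔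
      (i : ι) ∈ {i | X i ∉ Submodule.span ℝ (X '' (Subtype.val '' B \ {(b : ι)}))} := by
    intro i
    rw [deletion_image, Set.image_sdiff Subtype.val_injective, Set.image_singleton]
    rfl
  exact hB.2 b ⟨hb, hbI, (h b).mpr hmem, fun i hi => hmax ((h i).mp hi)⟩

/-- Spans in the contraction are spans in `X` with `x` adjoined, so activity of `b ≠ x` carries
over. If `x` itself were active then, being first, it would be the only member outside the span of
`B`, and the others would not span. -/
theorem insert_mem_internalBases {k : ℕ} {ι : Type*} [Finite ι] [LinearOrder ι]
    {X : ι → Fin (k + 1) → ℝ} {x : ι} {φ : (Fin (k + 1) → ℝ) →ₗ[ℝ] (Fin k → ℝ)}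
    (hs : Function.Surjective φ) (hφ : LinearMap.ker φ = Submodule.span ℝ {X x})
    {I : Set ι} (hmin : ∀ i, x ≤ i)
    (hx : x ∉ I ∨ Submodule.span ℝ (Set.range (deletion X x)) = ⊤) {B : Set {i : ι // i ≠ x}}
    (hB : B ∈ internalBases (contraction X x φ) (Subtype.val ⁻¹' I)) :
    insert x (Subtype.val '' B) ∈ internalBases X I := by
  have hC := (mem_bases_contraction hs hφ).mp hB.1
  refine ⟨hC, ?_⟩
  rintro b ⟨hb, hbI, hmem, hmax⟩
  by_cases hbx : b = x
  · subst hbx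
    refine hmem ?_
    have h1 : Submodule.span ℝ (Set.range (deletion X b)) ≤
        Submodule.span ℝ (X '' (insert b (Subtype.val '' B) \ {b})) := by
      refine Submodule.span_le.mpr ?_
      rintro _ ⟨i, rfl⟩
      by_contra hi
      exact i.2 (le_antisymm (hmax hi) (hmin i))
    rw [hx.resolve_left (not_not_intro hbI)] at h1
    exact h1 trivial
  · have hbB : (⟨b, hbx⟩ : {i : ι // i ≠ x}) ∈ B := by
      obtain ⟨c, hc, rfl⟩ := hb.resolve_left hbx
      exact hc
    have h : ∀ i : {i : ι // i ≠ x}, i ∈ {i | contraction X x φ i ∉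
        Submodule.span ℝ (contraction X x φ '' (B \ {⟨b, hbx⟩}))} ↔
        (i : ι) ∈ {i | X i ∉ Submodule.span ℝ (X '' (insert x (Subtype.val '' B) \ {b}))} := by
      intro i
      rw [Set.mem_ofPred_eq, contraction, mem_span_contraction hφ,
        Set.image_sdiff Subtype.val_injective, Set.image_singleton,
        Set.insert_sdiff_of_notMem _ (show x ∉ {b} from fun h => hbx h.symm)]
      rfl
    exact hB.2 ⟨b, hbx⟩ ⟨hbB, hbI, (h _).mpr hmem, fun i hi => hmax ((h i).mp hi)⟩

/-- The deletion–contraction bound for the number of internal bases, at the first member. -/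
theorem le_ncard_internalBases {k : ℕ} {ι : Type*} [Finite ι] [LinearOrder ι]
    {X : ι → Fin (k + 1) → ℝ} {x : ι} {φ : (Fin (k + 1) → ℝ) →ₗ[ℝ] (Fin k → ℝ)}
    (hs : Function.Surjective φ) (hφ : LinearMap.ker φ = Submodule.span ℝ {X x})
    {I : Set ι} (hmin : ∀ i, x ≤ i)
    (hx : x ∉ I ∨ Submodule.span ℝ (Set.range (deletion X x)) = ⊤) :
    (internalBases (contraction X x φ) (Subtype.val ⁻¹' I)).ncard +
      (internalBases (deletion X x) (Subtype.val ⁻¹' I)).ncard ≤ (internalBases X I).ncard := by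
  have hinj : Function.Injective fun B : Set {i : ι // i ≠ x} => Subtype.val '' B :=
    Set.image_injective.mpr Subtype.val_injective
  have hinj' : Function.Injective fun B : Set {i : ι // i ≠ x} => insert x (Subtype.val '' B) := by
    intro B C h
    have h2 : ∀ B : Set {i : ι // i ≠ x}, insert x (Subtype.val '' B) \ {x} = Subtype.val '' B :=
      fun B => Set.insert_sdiff_self_of_notMem (by simp)
    exact hinj (by simpa only [h2] using congrArg (· \ {x}) h)
  rw [← Set.ncard_image_of_injective _ hinj', ← Set.ncard_image_of_injective _ hinj,
    ← Set.ncard_union_eq]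
  · refine Set.ncard_le_ncard (Set.union_subset ?_ ?_)
    · rintro _ ⟨B, hB, rfl⟩
      exact insert_mem_internalBases hs hφ hmin hx hB
    · rintro _ ⟨B, hB, rfl⟩
      exact image_val_mem_internalBases hB
  · rw [Set.disjoint_left]
    rintro _ ⟨B, -, rfl⟩ ⟨C, -, h⟩
    have : x ∈ Subtype.val '' C := by
      change Subtype.val '' C = _ at h
      rw [h]
      exact Set.mem_insert _ _
    simp at this

theorem ncard_internalBases_deletion_le {n : ℕ} {ι : Type*} [Finite ι] [LinearOrder ι]
    (X : ι → Fin n → ℝ) (x : ι) (I : Set ι) :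
    (internalBases (deletion X x) (Subtype.val ⁻¹' I)).ncard ≤ (internalBases X I).ncard := by
  rw [← Set.ncard_image_of_injective _ (Set.image_injective.mpr Subtype.val_injective)]
  refine Set.ncard_le_ncard ?_
  rintro _ ⟨B, hB, rfl⟩
  exact image_val_mem_internalBases hB

theorem internalBases_empty {n : ℕ} {ι : Type*} [LinearOrder ι] (X : ι → Fin n → ℝ) :
    internalBases X ∅ = bases X := by
  ext B
  simp [internalBases, IsInternallyActive]

/-! ### The space cut out by the facets, and its upper bound -/

theorem finite_of_map_of_inf_ker {V W : Type*} [AddCommGroup V] [Module ℂ V] [AddCommGroup W]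
    [Module ℂ W] (L : V →ₗ[ℂ] W) (K : Submodule ℂ V) [FiniteDimensional ℂ (K.map L)]
    [FiniteDimensional ℂ (K ⊓ LinearMap.ker L : Submodule ℂ V)] : FiniteDimensional ℂ K :=
  Module.Finite.iff_fg.mpr <| Submodule.fg_of_fg_map_of_fg_inf_ker L
    (Module.Finite.iff_fg.mp inferInstance) (Module.Finite.iff_fg.mp inferInstance)

theorem finrank_map_add_finrank_inf_ker {V W : Type*} [AddCommGroup V] [Module ℂ V]
    [AddCommGroup W] [Module ℂ W] (L : V →ₗ[ℂ] W) (K : Submodule ℂ V) [FiniteDimensional ℂ K] :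
    Module.finrank ℂ (K.map L) + Module.finrank ℂ (K ⊓ LinearMap.ker L : Submodule ℂ V) =
      Module.finrank ℂ K := by
  have h := LinearMap.finrank_range_add_finrank_ker (L.domRestrict K)
  rw [LinearMap.range_domRestrict] at h
  rw [← h, LinearMap.ker_domRestrict]
  rw [← Submodule.map_comap_subtype]
  congr 1
  exact (Submodule.equivSubtypeMap K _).symm.finrank_eq

/-- The number of members of `X` on which `f` does not vanish. -/
noncomputable def multOff {n : ℕ} {ι : Type*} (X : ι → Fin n → ℝ) (f : (Fin n → ℝ) →ₗ[ℝ] ℝ) : ℕ :=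
  {i : ι | f (X i) ≠ 0}.ncard

/-- `f` is a nonzero functional whose kernel is spanned by members of `X`. -/
def IsFacetForm {n : ℕ} {ι : Type*} (X : ι → Fin n → ℝ) (f : (Fin n → ℝ) →ₗ[ℝ] ℝ) : Prop :=
  f ≠ 0 ∧ LinearMap.ker f ≤ Submodule.span ℝ (X '' {i | f (X i) = 0})

open Classical in
/-- The exponent `m(F)`, lowered by one if `I` is not contained in `F = ker f`. -/
noncomputable def facetExponent {n : ℕ} {ι : Type*} (X : ι → Fin n → ℝ) (I : Set ι)
    (f : (Fin n → ℝ) →ₗ[ℝ] ℝ) : ℕ :=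
  multOff X f - if ∃ i ∈ I, f (X i) ≠ 0 then 1 else 0

/-- The polynomials killed by the powers of the derivatives along the facet normals, with the
exponents `facetExponent`. -/
noncomputable def facetKer {n : ℕ} {ι : Type*} (X : ι → Fin n → ℝ) (I : Set ι) :
    Submodule ℂ (MvPolynomial (Fin n) ℂ) :=
  ⨅ (f : (Fin n → ℝ) →ₗ[ℝ] ℝ) (_ : IsFacetForm X f), LinearMap.ker (dirDiff f ^ facetExponent X I f)

theorem mem_facetKer {n : ℕ} {ι : Type*} {X : ι → Fin n → ℝ} {I : Set ι}
    {q : MvPolynomial (Fin n) ℂ} :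
    q ∈ facetKer X I ↔ ∀ f, IsFacetForm X f → (dirDiff f ^ facetExponent X I f) q = 0 := by
  simp [facetKer]

theorem multOff_eq_of_embedding {n k : ℕ} {ι κ : Type*} {X : ι → Fin n → ℝ} {Z : κ → Fin k → ℝ}
    {f : (Fin n → ℝ) →ₗ[ℝ] ℝ} {g : (Fin k → ℝ) →ₗ[ℝ] ℝ} {e : κ → ι} (he : Function.Injective e)
    (hfg : ∀ j, g (Z j) = f (X (e j))) (hr : ∀ i, f (X i) ≠ 0 → i ∈ Set.range e) :
    multOff Z g = multOff X f := by
  rw [multOff, multOff, ← Set.ncard_image_of_injective _ he]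
  congr 1
  ext i
  constructor
  · rintro ⟨j, hj, rfl⟩
    exact (hfg j).symm.trans_ne hj
  · intro hi
    obtain ⟨j, rfl⟩ := hr i hi
    exact ⟨j, (hfg j).trans_ne hi, rfl⟩

theorem multOff_deletion {n : ℕ} {ι : Type*} [Finite ι] {X : ι → Fin n → ℝ} {x : ι}
    {f : (Fin n → ℝ) →ₗ[ℝ] ℝ} (hx : f (X x) ≠ 0) :
    multOff X f = multOff (deletion X x) f + 1 := by
  have h : {i : ι | f (X i) ≠ 0} =
      insert x (Subtype.val '' {i : {i : ι // i ≠ x} | f (deletion X x i) ≠ 0}) := by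
    ext i
    by_cases hi : i = x
    · simp [hi, hx]
    · simp [hi, deletion]
  rw [multOff, multOff, h, Set.ncard_insert_of_notMem (by simp),
    Set.ncard_image_of_injective _ Subtype.val_injective]

theorem facetExponent_eq_of_embedding {n k : ℕ} {ι κ : Type*} {X : ι → Fin n → ℝ}
    {Z : κ → Fin k → ℝ} {f : (Fin n → ℝ) →ₗ[ℝ] ℝ} {g : (Fin k → ℝ) →ₗ[ℝ] ℝ} {e : κ → ι}
    (he : Function.Injective e) (hfg : ∀ j, g (Z j) = f (X (e j)))
    (hr : ∀ i, f (X i) ≠ 0 → i ∈ Set.range e) (I : Set ι) :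
    facetExponent Z (e ⁻¹' I) g = facetExponent X I f := by
  classical
  have h : (∃ j ∈ e ⁻¹' I, g (Z j) ≠ 0) ↔ ∃ i ∈ I, f (X i) ≠ 0 := by
    constructor
    · rintro ⟨j, hj, hj2⟩
      exact ⟨e j, hj, (hfg j).symm.trans_ne hj2⟩
    · rintro ⟨i, hi, hi2⟩
      obtain ⟨j, rfl⟩ := hr i hi2
      exact ⟨j, hi, (hfg j).trans_ne hi2⟩
  rw [facetExponent, facetExponent, multOff_eq_of_embedding he hfg hr]
  congr 1
  exact if_congr h rfl rfl

theorem facetExponent_empty {n : ℕ} {ι : Type*} (X : ι → Fin n → ℝ) (f : (Fin n → ℝ) →ₗ[ℝ] ℝ) :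
    facetExponent X ∅ f = multOff X f := by
  simp [facetExponent]

theorem facetKer_anti {n : ℕ} {ι : Type*} (X : ι → Fin n → ℝ) {I J : Set ι} (hIJ : I ⊆ J) :
    facetKer X J ≤ facetKer X I := by
  classical
  intro q hq
  rw [mem_facetKer] at hq ⊢
  intro f hf
  refine dirDiff_pow_eq_zero_of_le (Nat.sub_le_sub_left ?_ _) (hq f hf)
  by_cases h : ∃ i ∈ I, f (X i) ≠ 0
  · obtain ⟨i, hi, hi2⟩ := h
    have hJ : ∃ i ∈ J, f (X i) ≠ 0 := ⟨i, hIJ hi, hi2⟩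
    rw [if_pos hJ]
    split_ifs <;> omega
  · simp [h]

theorem IsFacetForm.of_deletion {n : ℕ} {ι : Type*} {X : ι → Fin n → ℝ} {x : ι}
    {f : (Fin n → ℝ) →ₗ[ℝ] ℝ} (hf : IsFacetForm (deletion X x) f) : IsFacetForm X f := by
  refine ⟨hf.1, hf.2.trans (Submodule.span_mono ?_)⟩
  rintro _ ⟨i, hi, rfl⟩
  exact ⟨i, hi, rfl⟩

theorem IsFacetForm.of_contraction {n k : ℕ} {ι : Type*} {X : ι → Fin n → ℝ} {x : ι}
    {φ : (Fin n → ℝ) →ₗ[ℝ] (Fin k → ℝ)} (hs : Function.Surjective φ)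
    (hφ : LinearMap.ker φ = Submodule.span ℝ {X x}) {f : (Fin k → ℝ) →ₗ[ℝ] ℝ}
    (hf : IsFacetForm (contraction X x φ) f) : IsFacetForm X (f ∘ₗ φ) := by
  have hx : φ (X x) = 0 := by
    rw [← LinearMap.mem_ker, hφ]
    exact Submodule.mem_span_singleton_self _
  refine ⟨fun h => hf.1 ?_, fun v hv => ?_⟩
  · refine LinearMap.ext fun w => ?_
    obtain ⟨v, rfl⟩ := hs w
    exact DFunLike.congr_fun h v
  · refine Submodule.span_mono (Set.image_mono ?_) ((mem_span_contraction hφ _ v).mp (hf.2 hv))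
    rintro i (rfl | ⟨j, hj, rfl⟩)
    · simp [hx]
    · exact hj

/-- A facet form of the contraction pulls back to one of `X` that vanishes at `x`, so deleting `x`
leaves its exponent unchanged. -/
theorem polyMap_mem_facetKer_contraction {n k : ℕ} {ι : Type*} {X : ι → Fin n → ℝ} {x : ι}
    {φ : (Fin n → ℝ) →ₗ[ℝ] (Fin k → ℝ)} (hs : Function.Surjective φ)
    (hφ : LinearMap.ker φ = Submodule.span ℝ {X x}) {I : Set ι} {q : MvPolynomial (Fin n) ℂ}
    (hq : q ∈ facetKer X I) :
    polyMap φ q ∈ facetKer (contraction X x φ) (Subtype.val ⁻¹' I) := by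
  have hx : φ (X x) = 0 := by
    rw [← LinearMap.mem_ker, hφ]
    exact Submodule.mem_span_singleton_self _
  rw [mem_facetKer] at hq ⊢
  intro f hf
  rw [← polyMap_dirDiff_pow, facetExponent_eq_of_embedding (Z := contraction X x φ) (X := X)
    (f := f ∘ₗ φ) Subtype.val_injective (fun _ => rfl), hq _ (hf.of_contraction hs hφ), map_zero]
  intro i hi
  refine ⟨⟨i, ?_⟩, rfl⟩
  rintro rfl
  simp [hx] at hi

theorem facetExponent_deletion_of_eq_zero {n : ℕ} {ι : Type*} {X : ι → Fin n → ℝ} {x : ι}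
    {f : (Fin n → ℝ) →ₗ[ℝ] ℝ} (hx : f (X x) = 0) (I : Set ι) :
    facetExponent (deletion X x) (Subtype.val ⁻¹' I) f = facetExponent X I f := by
  refine facetExponent_eq_of_embedding Subtype.val_injective (fun _ => rfl) (fun i hi => ?_) I
  refine ⟨⟨i, ?_⟩, rfl⟩
  rintro rfl
  exact hi hx

/-- The inequality can be strict: if `x` is the only member of `I` off `ker f`, the exponent of the
deletion is no longer lowered. -/
theorem facetExponent_sub_one_le {n : ℕ} {ι : Type*} [Finite ι] {X : ι → Fin n → ℝ} {x : ι}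
    {f : (Fin n → ℝ) →ₗ[ℝ] ℝ} (hx : f (X x) ≠ 0) (I : Set ι) :
    facetExponent X I f - 1 ≤ facetExponent (deletion X x) (Subtype.val ⁻¹' I) f := by
  classical
  rw [facetExponent, facetExponent, multOff_deletion hx]
  by_cases h : ∃ i ∈ I, f (X i) ≠ 0
  · rw [if_pos h]
    split_ifs <;> omega
  · rw [if_neg h, if_neg]
    · omega
    · rintro ⟨i, hi, hi2⟩
      exact h ⟨i, hi, hi2⟩

/-- The factor `p_x` absorbs one derivative along `f` if `f (X x) ≠ 0` and none otherwise, which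
covers the change of exponent. -/
theorem mem_facetKer_deletion {n : ℕ} {ι : Type*} [Finite ι] {X : ι → Fin n → ℝ} {x : ι}
    (hx : X x ≠ 0) {I : Set ι} {q : MvPolynomial (Fin n) ℂ}
    (hq : linForm (X x) * q ∈ facetKer X I) :
    q ∈ facetKer (deletion X x) (Subtype.val ⁻¹' I) := by
  rw [mem_facetKer] at hq ⊢
  intro f hf
  have h := hq f hf.of_deletion
  by_cases hfx : f (X x) = 0
  · rw [facetExponent_deletion_of_eq_zero hfx]
    rw [dirDiff_pow_linForm_mul_of_eq_zero hfx] at h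
    exact (mul_eq_zero.mp h).resolve_left (linForm_ne_zero hx)
  · exact dirDiff_pow_eq_zero_of_le (facetExponent_sub_one_le hfx I)
      (dirDiff_pow_pred_eq_zero hfx h)

theorem facetKer_le_deletion_of_eq_zero {n : ℕ} {ι : Type*} {X : ι → Fin n → ℝ} {x : ι}
    (hx : X x = 0) (I : Set ι) :
    facetKer X I ≤ facetKer (deletion X x) (Subtype.val ⁻¹' I) := by
  intro q hq
  rw [mem_facetKer] at hq ⊢
  intro f hf
  rw [facetExponent_deletion_of_eq_zero (by simp [hx])]
  exact hq f hf.of_deletion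

/-- If the spanning family `X` does not span without `x`, then the other members span a facet
hyperplane. -/
theorem exists_facetForm_of_coloop {n : ℕ} {ι : Type*} {X : ι → Fin n → ℝ}
    (hX : Submodule.span ℝ (Set.range X) = ⊤) {x : ι}
    (hx : Submodule.span ℝ (Set.range (deletion X x)) ≠ ⊤) :
    ∃ f, IsFacetForm (deletion X x) f ∧ f (X x) ≠ 0 ∧ multOff (deletion X x) f = 0 := by
  obtain ⟨f, hf0, hf⟩ := Submodule.exists_le_ker_of_lt_top _ (lt_top_iff_ne_top.mpr hx)
  have hf1 : ∀ i : {i : ι // i ≠ x}, f (deletion X x i) = 0 := fun i =>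
    hf (Submodule.subset_span ⟨i, rfl⟩)
  have hins : Set.range X = insert (X x) (Set.range (deletion X x)) := by
    ext v
    constructor
    · rintro ⟨i, rfl⟩
      by_cases hi : i = x
      · exact Or.inl (hi ▸ rfl)
      · exact Or.inr ⟨⟨i, hi⟩, rfl⟩
    · rintro (rfl | ⟨i, rfl⟩)
      · exact ⟨x, rfl⟩
      · exact ⟨i, rfl⟩
  have hdec : ∀ v, ∃ c : ℝ, ∃ u ∈ Submodule.span ℝ (Set.range (deletion X x)),
      v = c • X x + u := by
    intro v
    have : v ∈ Submodule.span ℝ (Set.range X) := hX ▸ Submodule.mem_top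
    rw [hins, Submodule.mem_span_insert] at this
    exact this
  have hfx : f (X x) ≠ 0 := by
    intro h
    refine hf0 (LinearMap.ext fun v => ?_)
    obtain ⟨c, u, hu, rfl⟩ := hdec v
    have := hf hu
    rw [LinearMap.mem_ker] at this
    simp [h, this]
  refine ⟨f, ⟨hf0, fun v hv => ?_⟩, hfx, ?_⟩
  · obtain ⟨c, u, hu, rfl⟩ := hdec v
    have := hf hu
    rw [LinearMap.mem_ker] at this hv
    have hc : c = 0 := by simpa [this, hfx] using hv
    rw [hc, zero_smul, zero_add]
    refine Submodule.span_mono ?_ hu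
    rintro _ ⟨i, rfl⟩
    exact ⟨i, hf1 i, rfl⟩
  · simp [multOff, hf1]

/-- The facet spanned by the members other than `x` has multiplicity `0` in the deletion, so the
identity operator is among the conditions. -/
theorem facetKer_deletion_eq_bot {n : ℕ} {ι : Type*} {X : ι → Fin n → ℝ}
    (hX : Submodule.span ℝ (Set.range X) = ⊤) {x : ι}
    (hx : Submodule.span ℝ (Set.range (deletion X x)) ≠ ⊤) (J : Set {i : ι // i ≠ x}) :
    facetKer (deletion X x) J = ⊥ := by
  obtain ⟨f, hf, -, hm⟩ := exists_facetForm_of_coloop hX hx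
  rw [eq_bot_iff]
  intro q hq
  have := mem_facetKer.mp hq f hf
  rw [facetExponent, hm, Nat.zero_sub, pow_zero] at this
  exact this

/-- Here that facet has multiplicity `1` in `X`, and `x ∈ I` lowers the exponent to `0`. -/
theorem facetKer_eq_bot_of_mem {n : ℕ} {ι : Type*} [Finite ι] {X : ι → Fin n → ℝ}
    (hX : Submodule.span ℝ (Set.range X) = ⊤) {x : ι}
    (hx : Submodule.span ℝ (Set.range (deletion X x)) ≠ ⊤) {I : Set ι} (hxI : x ∈ I) :
    facetKer X I = ⊥ := by
  obtain ⟨f, hf, hfx, hm⟩ := exists_facetForm_of_coloop hX hx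
  rw [eq_bot_iff]
  intro q hq
  have := mem_facetKer.mp hq f hf.of_deletion
  rw [facetExponent, multOff_deletion hfx, hm, if_pos ⟨x, hxI, hfx⟩, Nat.sub_self, pow_zero] at this
  exact this

theorem span_range_deletion_of_eq_zero {n : ℕ} {ι : Type*} {X : ι → Fin n → ℝ}
    (hX : Submodule.span ℝ (Set.range X) = ⊤) {x : ι} (hx : X x = 0) :
    Submodule.span ℝ (Set.range (deletion X x)) = ⊤ := by
  rw [eq_top_iff, ← hX, Submodule.span_le]
  rintro _ ⟨i, rfl⟩
  by_cases hi : i = x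
  · rw [hi, hx]
    exact Submodule.zero_mem _
  · exact Submodule.subset_span ⟨⟨i, hi⟩, rfl⟩

theorem span_range_contraction {n k : ℕ} {ι : Type*} {X : ι → Fin n → ℝ}
    (hX : Submodule.span ℝ (Set.range X) = ⊤) {x : ι}
    {φ : (Fin n → ℝ) →ₗ[ℝ] (Fin k → ℝ)} (hs : Function.Surjective φ)
    (hφ : LinearMap.ker φ = Submodule.span ℝ {X x}) :
    Submodule.span ℝ (Set.range (contraction X x φ)) = ⊤ := by
  rw [← Set.image_univ, span_contraction_eq_top hs hφ, ← hX, ← Set.image_univ]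
  congr 2
  ext i
  simp [em]

theorem facetKer_inf_ker_polyMap_le {n k : ℕ} {ι : Type*} [Finite ι] {X : ι → Fin n → ℝ} {x : ι}
    (hx : X x ≠ 0) {φ : (Fin n → ℝ) →ₗ[ℝ] (Fin k → ℝ)} {σ : (Fin k → ℝ) →ₗ[ℝ] (Fin n → ℝ)}
    (hσ : ∀ w, φ (σ w) = w) (hφ : LinearMap.ker φ = Submodule.span ℝ {X x}) (I : Set ι) :
    facetKer X I ⊓ LinearMap.ker (polyMap φ).toLinearMap ≤
      (facetKer (deletion X x) (Subtype.val ⁻¹' I)).map (LinearMap.mulLeft ℂ (linForm (X x))) := by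
  rintro q ⟨hq, hq2⟩
  obtain ⟨r, rfl⟩ := linForm_dvd_of_polyMap_eq_zero hσ hφ (LinearMap.mem_ker.mp hq2)
  exact ⟨r, mem_facetKer_deletion hx hq, rfl⟩

/-- The dimension of the space cut out by the facets is at most the number of internal bases. -/
theorem finrank_facetKer_le {n : ℕ} {ι : Type*} [Finite ι] [LinearOrder ι] (X : ι → Fin n → ℝ)
    (hX : Submodule.span ℝ (Set.range X) = ⊤) (I : Set ι) (hI : ∀ x, x ∉ I → ∀ y ∈ I, x < y) :
    FiniteDimensional ℂ (facetKer X I) ∧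
      Module.finrank ℂ (facetKer X I) ≤ (internalBases X I).ncard := by
  induction hc : Nat.card ι using Nat.strong_induction_on generalizing n ι with
  | _ c ih =>
  subst hc
  rcases isEmpty_or_nonempty ι with hι | hι
  · have hn : n = 0 := by
      rw [Set.range_eq_empty, Submodule.span_empty] at hX
      have := congrArg (fun S : Submodule ℝ (Fin n → ℝ) => Module.finrank ℝ S) hX
      simpa [eq_comm] using this
    subst hn
    have hfin : Module.finrank ℂ (MvPolynomial (Fin 0) ℂ) = 1 := by
      rw [(MvPolynomial.isEmptyAlgEquiv ℂ (Fin 0)).toLinearEquiv.finrank_eq, Module.finrank_self]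
    -- In dimension `0` all polynomials are constants, and the empty set is an internal basis.
    have : FiniteDimensional ℂ (MvPolynomial (Fin 0) ℂ) :=
      Module.finite_of_finrank_pos (by omega)
    refine ⟨inferInstance, (Submodule.finrank_le _).trans ?_⟩
    rw [hfin, Nat.succ_le_iff, Set.ncard_pos]
    refine ⟨∅, mem_bases_iff.mpr ⟨Subsingleton.elim _ _, by simp⟩, fun b => hι.elim b⟩
  -- The splitting is done at the first member, since it can be active only if the other members do
  -- not span.
  · obtain ⟨x, hmin⟩ := Finite.exists_min (id : ι → ι)
    have hcard : Nat.card {i : ι // i ≠ x} < Nat.card ι := Finite.card_subtype_lt (x := x) (by simp)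
    have hI' : ∀ i : {i : ι // i ≠ x}, i ∉ (Subtype.val ⁻¹' I : Set {i : ι // i ≠ x}) →
        ∀ j ∈ (Subtype.val ⁻¹' I : Set {i : ι // i ≠ x}), i < j := fun i hi j hj => hI i hi j hj
    by_cases hx : X x = 0
    · obtain ⟨h1, h2⟩ := ih _ hcard (deletion X x) (span_range_deletion_of_eq_zero hX hx) _ hI' rfl
      have hle := facetKer_le_deletion_of_eq_zero hx I
      exact ⟨Submodule.finiteDimensional_of_le hle, (Submodule.finrank_mono hle).trans
        (h2.trans (ncard_internalBases_deletion_le X x I))⟩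
    by_cases hcol : x ∈ I ∧ Submodule.span ℝ (Set.range (deletion X x)) ≠ ⊤
    · rw [facetKer_eq_bot_of_mem hX hcol.2 hcol.1]
      exact ⟨inferInstance, by simp⟩
    obtain ⟨k, rfl⟩ : ∃ k, n = k + 1 := by
      refine Nat.exists_eq_succ_of_ne_zero ?_
      rintro rfl
      exact hx (Subsingleton.elim _ _)
    obtain ⟨φ, σ, hσ, hφ⟩ := exists_contraction hx
    have hs : Function.Surjective φ := fun w => ⟨σ w, hσ w⟩
    obtain ⟨h1, h2⟩ := ih _ hcard (contraction X x φ) (span_range_contraction hX hs hφ) _ hI' rfl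
    have hdel : FiniteDimensional ℂ (facetKer (deletion X x) (Subtype.val ⁻¹' I)) ∧
        Module.finrank ℂ (facetKer (deletion X x) (Subtype.val ⁻¹' I)) ≤
          (internalBases (deletion X x) (Subtype.val ⁻¹' I)).ncard := by
      by_cases hsp : Submodule.span ℝ (Set.range (deletion X x)) = ⊤
      · exact ih _ hcard _ hsp _ hI' rfl
      · rw [facetKer_deletion_eq_bot hX hsp]
        exact ⟨inferInstance, by simp⟩
    obtain ⟨h3, h4⟩ := hdel
    have hle1 : (facetKer X I).map (polyMap φ).toLinearMap ≤
        facetKer (contraction X x φ) (Subtype.val ⁻¹' I) := by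
      rintro _ ⟨q, hq, rfl⟩
      exact polyMap_mem_facetKer_contraction hs hφ hq
    have hle2 := facetKer_inf_ker_polyMap_le hx hσ hφ I
    have := Submodule.finiteDimensional_of_le hle1
    have := Submodule.finiteDimensional_of_le hle2
    have hfd := finite_of_map_of_inf_ker (polyMap φ).toLinearMap (facetKer X I)
    refine ⟨hfd, ?_⟩
    rw [← finrank_map_add_finrank_inf_ker (polyMap φ).toLinearMap]
    refine (add_le_add ((Submodule.finrank_mono hle1).trans h2) ((Submodule.finrank_mono hle2).trans
      ((Submodule.finrank_map_le _ _).trans h4))).trans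
        (le_ncard_internalBases hs hφ hmin ?_)
    tauto

/-! ### The central space -/

instance finiteDimensional_centralSpace {n : ℕ} {ι : Type*} [Finite ι] (X : ι → Fin n → ℝ) :
    FiniteDimensional ℂ (centralSpace X) := by
  refine FiniteDimensional.span_of_finite ℂ
    ((Set.finite_range fun Y : Finset ι => ∏ y ∈ Y, linForm (X y)).subset ?_)
  rintro p ⟨Y, -, rfl⟩
  exact ⟨Y, rfl⟩

theorem exists_notMem_of_span_eq_top {n : ℕ} {ι : Type*} {X : ι → Fin n → ℝ}
    {f : (Fin n → ℝ) →ₗ[ℝ] ℝ} (hf : f ≠ 0) {S : Set ι} (hS : Submodule.span ℝ (X '' S) = ⊤) :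
    ∃ i ∈ S, f (X i) ≠ 0 := by
  by_contra! h
  refine hf (LinearMap.ker_eq_top.mp ?_)
  rw [eq_top_iff, ← hS, Submodule.span_le]
  rintro _ ⟨i, hi, rfl⟩
  exact h i hi

open Classical in
theorem multOff_eq {n : ℕ} {ι : Type*} [Finite ι] (X : ι → Fin n → ℝ)
    (f : (Fin n → ℝ) →ₗ[ℝ] ℝ) (Y : Finset ι) :
    multOff X f = (Y.filter fun y => f (X y) ≠ 0).card +
      ({i | f (X i) ≠ 0} \ (Y : Set ι)).ncard := by
  rw [multOff, ← Set.ncard_inter_add_ncard_sdiff_eq_ncard _ (Y : Set ι), ← Set.ncard_coe_finset]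
  congr 2
  ext i
  simp [and_comm]

/-- The derivatives of order `multOff X f` kill `𝒫(X)`, for every functional `f ≠ 0`. -/
theorem dirDiff_pow_multOff_eq_zero {n : ℕ} {ι : Type*} [Finite ι] {X : ι → Fin n → ℝ}
    {f : (Fin n → ℝ) →ₗ[ℝ] ℝ} (hf : f ≠ 0) {q : MvPolynomial (Fin n) ℂ}
    (hq : q ∈ centralSpace X) : (dirDiff f ^ multOff X f) q = 0 := by
  classical
  have h : centralSpace X ≤ LinearMap.ker (dirDiff f ^ multOff X f) := by
    refine Submodule.span_le.mpr ?_
    rintro p ⟨Y, hY, rfl⟩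
    -- Some member off `ker f` is missing from `Y`, so fewer than `multOff X f` factors vary along
    -- `f`.
    obtain ⟨i, hi, hi2⟩ := exists_notMem_of_span_eq_top hf hY
    refine dirDiff_pow_prod_eq_zero f X Y ?_
    rw [multOff_eq X f Y, Nat.lt_add_right_iff_pos, Set.ncard_pos]
    exact ⟨i, hi2, hi⟩
  exact h hq

theorem centralSpace_le_facetKer {n : ℕ} {ι : Type*} [Finite ι] (X : ι → Fin n → ℝ) :
    centralSpace X ≤ facetKer X ∅ := by
  intro q hq
  rw [mem_facetKer]
  intro f hf
  rw [facetExponent_empty]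
  exact dirDiff_pow_multOff_eq_zero hf.1 hq

theorem linForm_mul_mem_centralSpace {n : ℕ} {ι : Type*} {X : ι → Fin n → ℝ} {x : ι} :
    (centralSpace (deletion X x)).map (LinearMap.mulLeft ℂ (linForm (X x))) ≤ centralSpace X := by
  classical
  rw [centralSpace, Submodule.map_span_le]
  rintro p ⟨Y, hY, rfl⟩
  refine Submodule.subset_span ⟨insert x (Y.map (Function.Embedding.subtype _)), ?_, ?_⟩
  · rw [eq_top_iff, ← hY, deletion_image]
    refine Submodule.span_mono (Set.image_mono ?_)
    rintro _ ⟨i, hi, rfl⟩ h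
    have : i ∈ Y := by simpa [i.2] using h
    exact hi this
  · rw [Finset.prod_insert (by simp), Finset.prod_map]
    rfl

theorem centralSpace_contraction_le {n k : ℕ} {ι : Type*} {X : ι → Fin n → ℝ} {x : ι}
    {φ : (Fin n → ℝ) →ₗ[ℝ] (Fin k → ℝ)} (hs : Function.Surjective φ)
    (hφ : LinearMap.ker φ = Submodule.span ℝ {X x}) :
    centralSpace (contraction X x φ) ≤ (centralSpace X).map (polyMap φ).toLinearMap := by
  refine Submodule.span_le.mpr ?_
  rintro p ⟨Y, hY, rfl⟩
  refine ⟨∏ y ∈ Y.map (Function.Embedding.subtype _), linForm (X y), Submodule.subset_span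
    ⟨_, ?_, rfl⟩, ?_⟩
  · rw [span_contraction_eq_top hs hφ] at hY
    rw [eq_top_iff, ← hY]
    refine Submodule.span_mono (Set.image_mono ?_)
    rintro i (rfl | ⟨j, hj, rfl⟩) h
    · simp at h
    · have : j ∈ Y := by simpa [j.2] using h
      exact hj this
  · rw [AlgHom.toLinearMap_apply, polyMap_prod, Finset.prod_map]
    rfl

theorem centralSpace_eq_top_of_isEmpty {ι : Type*} [IsEmpty ι] (X : ι → Fin 0 → ℝ) :
    centralSpace X = ⊤ := by
  rw [eq_top_iff]
  intro q _
  have h1 : (1 : MvPolynomial (Fin 0) ℂ) ∈ centralSpace X :=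
    Submodule.subset_span ⟨∅, Subsingleton.elim _ _, by simp⟩
  rw [eq_C_of_isEmpty q, ← mul_one (C _), ← smul_eq_C_mul]
  exact Submodule.smul_mem _ _ h1

/-- The image of `𝒫(X)` under `p_x ↦ 0` contains the central space of the contraction, and the
kernel contains `p_x 𝒫(X ∖ x)`. As `X` need not span, coloops require no separate case. -/
theorem ncard_bases_le_finrank {n : ℕ} {ι : Type*} [Finite ι] (X : ι → Fin n → ℝ) :
    (bases X).ncard ≤ Module.finrank ℂ (centralSpace X) := by
  induction hc : Nat.card ι using Nat.strong_induction_on generalizing n ι with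
  | _ c ih =>
  subst hc
  rcases isEmpty_or_nonempty ι with hι | ⟨⟨x⟩⟩
  · rcases Set.eq_empty_or_nonempty (bases X) with h | ⟨B, hB⟩
    · simp [h]
    · have hn : n = 0 := by
        rw [← (mem_bases_iff.mp hB).2, Set.eq_empty_of_isEmpty B, Set.ncard_empty]
      subst hn
      rw [centralSpace_eq_top_of_isEmpty, finrank_top,
        (MvPolynomial.isEmptyAlgEquiv ℂ (Fin 0)).toLinearEquiv.finrank_eq, Module.finrank_self]
      exact Set.ncard_le_one_iff_subsingleton.mpr Set.subsingleton_of_subsingleton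
  · have hcard : Nat.card {i : ι // i ≠ x} < Nat.card ι := Finite.card_subtype_lt (x := x) (by simp)
    by_cases hx : X x = 0
    · exact (ncard_bases_le_of_eq_zero hx).trans ((ih _ hcard (deletion X x) rfl).trans
        (Submodule.finrank_mono (centralSpace_deletion_le X x)))
    obtain ⟨k, rfl⟩ : ∃ k, n = k + 1 := by
      refine Nat.exists_eq_succ_of_ne_zero ?_
      rintro rfl
      exact hx (Subsingleton.elim _ _)
    obtain ⟨φ, σ, hσ, hφ⟩ := exists_contraction hx
    have hs : Function.Surjective φ := fun w => ⟨σ w, hσ w⟩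
    have hφx : φ (X x) = 0 := by
      rw [← LinearMap.mem_ker, hφ]
      exact Submodule.mem_span_singleton_self _
    refine (ncard_bases_le hs hφ).trans ((add_le_add (ih _ hcard (contraction X x φ) rfl)
      (ih _ hcard (deletion X x) rfl)).trans ?_)
    rw [← finrank_map_add_finrank_inf_ker (polyMap φ).toLinearMap (centralSpace X)]
    refine add_le_add (Submodule.finrank_mono (centralSpace_contraction_le hs hφ)) ?_
    have hinj : Function.Injective (LinearMap.mulLeft ℂ (linForm (X x))) :=
      fun _ _ h => mul_left_cancel₀ (linForm_ne_zero hx) h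
    rw [(Submodule.equivMapOfInjective _ hinj (centralSpace (deletion X x))).finrank_eq]
    refine Submodule.finrank_mono (le_inf linForm_mul_mem_centralSpace ?_)
    rintro _ ⟨q, -, rfl⟩
    rw [LinearMap.mem_ker, AlgHom.toLinearMap_apply, LinearMap.mulLeft_apply, map_mul,
      polyMap_linForm, hφx]
    simp [linForm]

theorem centralSpace_eq_facetKer {n : ℕ} {ι : Type*} [Finite ι] (X : ι → Fin n → ℝ)
    (hX : Submodule.span ℝ (Set.range X) = ⊤) : centralSpace X = facetKer X ∅ := by
  obtain ⟨m, ⟨e⟩⟩ := Finite.exists_equiv_fin ι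
  -- Any order serves: for `I = ∅` all bases are internal.
  let _ : LinearOrder ι := LinearOrder.lift' e e.injective
  obtain ⟨h1, h2⟩ := finrank_facetKer_le X hX ∅ (by simp)
  refine Submodule.eq_of_le_of_finrank_le (centralSpace_le_facetKer X) (h2.trans ?_)
  rw [internalBases_empty]
  exact ncard_bases_le_finrank X

/-! ### The semi-internal space as a facet kernel -/

theorem dirDiff_pow_facetExponent_eq_zero {n : ℕ} {ι : Type*} [Finite ι] {X : ι → Fin n → ℝ}
    {I : Set ι} {f : (Fin n → ℝ) →ₗ[ℝ] ℝ} (hf : f ≠ 0) {q : MvPolynomial (Fin n) ℂ}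
    (hq : q ∈ semiInternalSpace X I) : (dirDiff f ^ facetExponent X I f) q = 0 := by
  by_cases h : ∃ b ∈ I, f (X b) ≠ 0
  · rw [facetExponent, if_pos h]
    obtain ⟨b, hb, hfb⟩ := h
    rw [multOff_deletion hfb, Nat.add_sub_cancel]
    have := (Submodule.mem_inf.mp hq).2
    simp only [Submodule.mem_iInf] at this
    exact dirDiff_pow_multOff_eq_zero hf (this b hb)
  · rw [facetExponent, if_neg h]
    exact dirDiff_pow_multOff_eq_zero hf (Submodule.mem_inf.mp hq).1

/-- Deleting a `b ∈ I` off `ker f` lowers the multiplicity by one, as `I` does. Conversely, at each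
facet of `X ∖ b` the central exponent of `X ∖ b` is at least that of `(X, I)`. -/
theorem semiInternalSpace_eq_facetKer {n : ℕ} {ι : Type*} [Finite ι] (X : ι → Fin n → ℝ)
    (hX : Submodule.span ℝ (Set.range X) = ⊤) (I : Set ι) :
    semiInternalSpace X I = facetKer X I := by
  refine le_antisymm (fun q hq => ?_) (le_inf ?_ (le_iInf₂ fun b hb => ?_))
  · rw [mem_facetKer]
    exact fun f hf => dirDiff_pow_facetExponent_eq_zero hf.1 hq
  · rw [centralSpace_eq_facetKer X hX]
    exact facetKer_anti X (Set.empty_subset I)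
  · by_cases hsp : Submodule.span ℝ (Set.range (deletion X b)) = ⊤
    · rw [centralSpace_eq_facetKer _ hsp]
      intro q hq
      rw [mem_facetKer] at hq ⊢
      intro f hf
      refine dirDiff_pow_eq_zero_of_le ?_ (hq f hf.of_deletion)
      rw [facetExponent_empty]
      by_cases hfb : f (X b) = 0
      · rw [← facetExponent_deletion_of_eq_zero hfb]
        exact Nat.sub_le _ _
      · rw [facetExponent, if_pos ⟨b, hb, hfb⟩, multOff_deletion hfb, Nat.add_sub_cancel]
    · rw [facetKer_eq_bot_of_mem hX hsp hb]
      exact bot_le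

/-! ### Restriction to a hyperplane, and the lower bound -/

/-- The derivative of order `m(F) - 1` along the normal of a hyperplane `F = ker f` maps `𝒫(X)`
into the central space of the members `Z` of `X` that lie in `F`. -/
theorem dirDiff_pow_mem_map_centralSpace {n k : ℕ} {ι κ : Type*} [Finite ι]
    {X : ι → Fin n → ℝ} {Z : κ → Fin k → ℝ} {e : κ → ι} (he : Function.Injective e)
    {ψ : (Fin k → ℝ) →ₗ[ℝ] (Fin n → ℝ)} (hψ : Function.Injective ψ)
    {f : (Fin n → ℝ) →ₗ[ℝ] ℝ} (hf : f ≠ 0) (hψf : LinearMap.range ψ = LinearMap.ker f)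
    (hZ : ∀ j, ψ (Z j) = X (e j)) (hr : ∀ i, f (X i) = 0 → i ∈ Set.range e)
    {q : MvPolynomial (Fin n) ℂ} (hq : q ∈ centralSpace X) :
    (dirDiff f ^ (multOff X f - 1)) q ∈ (centralSpace Z).map (polyMap ψ).toLinearMap := by
  classical
  have hfψ : ∀ w, f (ψ w) = 0 := fun w => by
    rw [← LinearMap.mem_ker, ← hψf]
    exact ⟨w, rfl⟩
  suffices h : centralSpace X ≤ ((centralSpace Z).map (polyMap ψ).toLinearMap).comap
      (dirDiff f ^ (multOff X f - 1)) from h hq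
  refine Submodule.span_le.mpr ?_
  rintro p ⟨Y, hY, rfl⟩
  change (dirDiff f ^ (multOff X f - 1)) _ ∈ (centralSpace Z).map (polyMap ψ).toLinearMap
  have hm := multOff_eq X f Y
  obtain ⟨c, hcY, hfc⟩ := exists_notMem_of_span_eq_top hf hY
  have hpos : 0 < ({i | f (X i) ≠ 0} \ (Y : Set ι)).ncard :=
    (Set.ncard_pos).mpr ⟨c, hfc, hcY⟩
  -- If `Y` omits two members off `ker f`, the order of the derivative exceeds the number of factors
  -- that vary along `f`.
  by_cases hone : ({i | f (X i) ≠ 0} \ (Y : Set ι)).ncard = 1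
  swap
  · rw [dirDiff_pow_prod_eq_zero f X Y (by omega)]
    exact Submodule.zero_mem _
  rw [hm, hone, Nat.add_sub_cancel]
  obtain ⟨a, ha⟩ := exists_dirDiff_pow_prod f X Y
  rw [ha]
  refine Submodule.smul_mem _ _ ⟨∏ y ∈ Y.preimage e he.injOn, linForm (Z y),
    Submodule.subset_span ⟨_, ?_, rfl⟩, ?_⟩
  -- Outside `Y` there are only `c` and members in `ker f`. Applying `f` shows that vectors of `ker
  -- f` need no multiple of `X c`, so the latter members span `ker f`.
  · rw [Submodule.eq_top_iff']
    intro w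
    have hw : ψ w ∈ Submodule.span ℝ (X '' (Y : Set ι)ᶜ) := hY ▸ Submodule.mem_top
    have hsub : (Y : Set ι)ᶜ ⊆ insert c (e '' ((Y.preimage e he.injOn : Finset κ) : Set κ)ᶜ) := by
      intro i hi
      by_cases hfi : f (X i) = 0
      · obtain ⟨j, rfl⟩ := hr i hfi
        exact Or.inr ⟨j, by simpa using hi, rfl⟩
      · obtain ⟨d, hd⟩ := Set.ncard_eq_one.mp hone
        have h1 : i ∈ ({d} : Set ι) := hd ▸ ⟨hfi, hi⟩
        have h2 : c ∈ ({d} : Set ι) := hd ▸ ⟨hfc, hcY⟩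
        exact Or.inl (h1.trans h2.symm)
    have hw2 := Submodule.span_mono (Set.image_mono hsub) hw
    have himg : X '' (e '' ((Y.preimage e he.injOn : Finset κ) : Set κ)ᶜ) =
        ψ '' (Z '' ((Y.preimage e he.injOn : Finset κ) : Set κ)ᶜ) := by
      simp only [Set.image_image, hZ]
    rw [Set.image_insert_eq, himg, Submodule.mem_span_insert] at hw2
    obtain ⟨b, u, hu, hwu⟩ := hw2
    rw [← Submodule.map_span] at hu
    obtain ⟨u', hu', rfl⟩ := hu
    have hb : b = 0 := by
      have := congrArg f hwu
      simpa [hfψ, hfc] using this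
    rw [hb, zero_smul, zero_add] at hwu
    rw [hψ hwu]
    exact hu'
  · rw [AlgHom.toLinearMap_apply, polyMap_prod]
    simp only [hZ]
    rw [← Finset.prod_preimage e (Y.filter fun y => f (X y) = 0) he.injOn
      (fun y => linForm (X y))]
    · refine Finset.prod_congr ?_ fun _ _ => rfl
      ext j
      have : f (X (e j)) = 0 := by rw [← hZ, hfψ]
      simp [this]
    · intro i hi hi2
      exact absurd (hr i (Finset.mem_filter.mp hi).2) hi2

/-- Deleting a member inside `ker f` does not change the order of the derivative, and injectivity of
`polyMap ψ` makes the preimage the same for all deletions. -/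
theorem dirDiff_pow_mem_map_semiInternalSpace {n k : ℕ} {ι κ : Type*} [Finite ι]
    {X : ι → Fin n → ℝ} {Z : κ → Fin k → ℝ} {e : κ → ι} (he : Function.Injective e)
    {ψ : (Fin k → ℝ) →ₗ[ℝ] (Fin n → ℝ)} {ρ : (Fin n → ℝ) →ₗ[ℝ] (Fin k → ℝ)}
    (hρ : ∀ w, ρ (ψ w) = w)
    {f : (Fin n → ℝ) →ₗ[ℝ] ℝ} (hf : f ≠ 0) (hψf : LinearMap.range ψ = LinearMap.ker f)
    (hZ : ∀ j, ψ (Z j) = X (e j)) (hr : ∀ i, f (X i) = 0 → i ∈ Set.range e) {I : Set ι}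
    {q : MvPolynomial (Fin n) ℂ} (hq : q ∈ semiInternalSpace X I) :
    (dirDiff f ^ (multOff X f - 1)) q ∈
      (semiInternalSpace Z (e ⁻¹' I)).map (polyMap ψ).toLinearMap := by
  have hψ : Function.Injective ψ := Function.LeftInverse.injective hρ
  have hfψ : ∀ w, f (ψ w) = 0 := fun w => by
    rw [← LinearMap.mem_ker, ← hψf]
    exact ⟨w, rfl⟩
  obtain ⟨r, hr1, hr2⟩ :=
    dirDiff_pow_mem_map_centralSpace he hψ hf hψf hZ hr (Submodule.mem_inf.mp hq).1
  refine ⟨r, Submodule.mem_inf.mpr ⟨hr1, ?_⟩, hr2⟩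
  simp only [Submodule.mem_iInf]
  intro b hb
  have hqb := (Submodule.mem_inf.mp hq).2
  simp only [Submodule.mem_iInf] at hqb
  let e' : {j : κ // j ≠ b} → {i : ι // i ≠ e b} := fun j => ⟨e j, fun h => j.2 (he h)⟩
  have hfb : f (X (e b)) = 0 := by rw [← hZ, hfψ]
  obtain ⟨s, hs1, hs2⟩ := dirDiff_pow_mem_map_centralSpace (X := deletion X (e b))
    (Z := deletion Z b) (e := e') (fun i j h => Subtype.ext (he (congrArg Subtype.val h)))
    hψ hf hψf (fun j => hZ j) (fun i hi => by
      obtain ⟨j, hj⟩ := hr i hi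
      refine ⟨⟨j, fun h => i.2 ?_⟩, Subtype.ext hj⟩
      rw [← hj, h]) (hqb (e b) hb)
  have hm : multOff (deletion X (e b)) f = multOff X f :=
    multOff_eq_of_embedding Subtype.val_injective (fun _ => rfl) fun i hi =>
      ⟨⟨i, fun h => hi (h ▸ hfb)⟩, rfl⟩
  rw [hm, ← hr2] at hs2
  rwa [← polyMap_injective hρ hs2]

/-- The bases that contain `a` as the last member of `X` outside the hyperplane `F` spanned by
the other members, and have no active member in `I`. -/
def basesThrough {n : ℕ} {ι : Type*} [LinearOrder ι] (X : ι → Fin n → ℝ) (I : Set ι) (a : ι)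
    (F : Submodule ℝ (Fin n → ℝ)) : Set (Set ι) :=
  {B | B ∈ internalBases X I ∧ IsInternallyActive X {a} B a ∧
    Submodule.span ℝ (X '' (B \ {a})) = F}

theorem finrank_map_dirDiff_pow_le {n : ℕ} {ι : Type*} [Finite ι] [LinearOrder ι]
    {X : ι → Fin n → ℝ} {I : Set ι} (hI : ∀ x, x ∉ I → ∀ y ∈ I, x < y) {a : ι}
    (haI : ∀ x, x ∉ I → x ≤ a) {f : (Fin n → ℝ) →ₗ[ℝ] ℝ} (hf : IsFacetForm X f)
    (hfa : f (X a) ≠ 0) (hfI : ∀ i ∈ I, f (X i) = 0) :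
    Module.finrank ℂ ((semiInternalSpace X I).map (dirDiff f ^ (multOff X f - 1))) ≤
      (basesThrough X I a (LinearMap.ker f)).ncard := by
  obtain ⟨k, rfl⟩ : ∃ k, n = k + 1 := by
    refine Nat.exists_eq_succ_of_ne_zero ?_
    rintro rfl
    exact hfa (by rw [Subsingleton.elim (X a) 0, map_zero])
  obtain ⟨ψ, ρ, hρ, hψf⟩ := exists_hyperplane_param hf.1
  have hψ : Function.Injective ψ := Function.LeftInverse.injective hρ
  have hfψ : ∀ w, f (ψ w) = 0 := fun w => by
    rw [← LinearMap.mem_ker, ← hψf]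
    exact ⟨w, rfl⟩
  have hker : ∀ v, f v = 0 → ψ (ρ v) = v := by
    intro v hv
    rw [← LinearMap.mem_ker, ← hψf] at hv
    obtain ⟨w, rfl⟩ := hv
    rw [hρ]
  -- The members of `X` in the hyperplane, in coordinates on it.
  let Z : {i : ι // f (X i) = 0} → Fin k → ℝ := fun i => ρ (X i)
  have hZ : ∀ j, ψ (Z j) = X (Subtype.val j) := fun j => hker _ j.2
  have hspan : ∀ S : Set {i : ι // f (X i) = 0}, Submodule.span ℝ (X '' (Subtype.val '' S)) =
      (Submodule.span ℝ (Z '' S)).map ψ := by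
    intro S
    rw [Submodule.map_span, Set.image_image, Set.image_image]
    simp only [hZ]
  have hZtop : Submodule.span ℝ (Set.range Z) = ⊤ := by
    refine Submodule.map_injective_of_injective hψ ?_
    rw [← Set.image_univ, ← hspan, Submodule.map_top, hψf]
    refine le_antisymm (Submodule.span_le.mpr ?_) (hf.2.trans (Submodule.span_mono ?_))
    · rintro _ ⟨_, ⟨i, -, rfl⟩, rfl⟩
      exact i.2
    · rintro _ ⟨i, hi, rfl⟩
      exact ⟨i, ⟨⟨i, hi⟩, trivial, rfl⟩, rfl⟩
  obtain ⟨hfd, hle⟩ := finrank_facetKer_le Z hZtop (Subtype.val ⁻¹' I)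
    (fun i hi j hj => hI i hi j hj)
  rw [← semiInternalSpace_eq_facetKer Z hZtop] at hfd hle
  have hmap : (semiInternalSpace X I).map (dirDiff f ^ (multOff X f - 1)) ≤
      (semiInternalSpace Z (Subtype.val ⁻¹' I)).map (polyMap ψ).toLinearMap := by
    rintro _ ⟨q, hq, rfl⟩
    exact dirDiff_pow_mem_map_semiInternalSpace Subtype.val_injective hρ hf.1 hψf hZ
      (fun i hi => ⟨⟨i, hi⟩, rfl⟩) hq
  refine (Submodule.finrank_mono hmap).trans ((Submodule.finrank_map_le _ _).trans
    (hle.trans ?_))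
  have haS : ∀ S : Set {i : ι // f (X i) = 0}, a ∉ (Subtype.val '' S : Set ι) := by
    rintro S ⟨i, -, rfl⟩
    exact hfa i.2
  have hdiff : ∀ S : Set {i : ι // f (X i) = 0}, insert a (Subtype.val '' S) \ {a} =
      Subtype.val '' S := fun S => Set.insert_sdiff_self_of_notMem (haS S)
  have hinj : Function.Injective fun S : Set {i : ι // f (X i) = 0} =>
      insert a (Subtype.val '' S) := by
    intro S T h
    exact Set.image_injective.mpr Subtype.val_injective
      (by simpa only [hdiff] using congrArg (· \ {a}) h)
  rw [← Set.ncard_image_of_injective _ hinj]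
  refine Set.ncard_le_ncard ?_
  rintro _ ⟨B, hB, rfl⟩
  have hBker : Submodule.span ℝ (X '' (Subtype.val '' B)) = LinearMap.ker f := by
    rw [hspan, (mem_bases_iff.mp hB.1).1, Submodule.map_top, hψf]
  have hbasis : insert a (Subtype.val '' B) ∈ bases X := by
    refine mem_bases_iff.mpr ⟨?_, ?_⟩
    · rw [Submodule.eq_top_iff']
      intro v
      rw [Set.image_insert_eq, Submodule.mem_span_insert]
      refine ⟨f v / f (X a), v - (f v / f (X a)) • X a, ?_, by abel⟩
      rw [hBker, LinearMap.mem_ker]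
      simp [hfa]
    · rw [Set.ncard_insert_of_notMem (haS B), Set.ncard_image_of_injective _ Subtype.val_injective,
        (mem_bases_iff.mp hB.1).2]
  refine ⟨⟨hbasis, ?_⟩, ⟨Set.mem_insert _ _, rfl, ?_, ?_⟩, ?_⟩
  -- An active `b` would already be active in `B`: `X a` is off `ker f`, so it adds no vector of
  -- `ker f` to the span.
  · rintro b ⟨hb, hbI, -, hmax⟩
    have hba : b ≠ a := fun h => hfa (h ▸ hfI b hbI)
    obtain ⟨b, hbB, rfl⟩ := hb.resolve_left hba
    refine hB.2 b ⟨hbB, hbI, notMem_span_of_mem_bases hB.1 hbB, fun i hi => hmax ?_⟩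
    intro hi2
    refine hi ?_
    rw [Set.insert_sdiff_of_notMem _ (show a ∉ {(b : ι)} from fun h => hba h.symm),
      ← Set.image_singleton (f := Subtype.val), ← Set.image_sdiff Subtype.val_injective,
      Set.image_insert_eq, Submodule.mem_span_insert] at hi2
    obtain ⟨c, u, hu, hcu⟩ := hi2
    rw [hspan] at hu
    obtain ⟨u', hu', rfl⟩ := hu
    have hc : c = 0 := by
      have := congrArg f hcu
      simpa [hfψ, hfa, i.2] using this
    rw [hc, zero_smul, zero_add, ← hZ] at hcu
    rw [hψ hcu]
    exact hu'
  · rw [Set.mem_ofPred_eq, hdiff, hBker]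
    exact hfa
  -- A member off `ker f` is not in `I`, so it does not come after `a`.
  · intro i hi
    rw [Set.mem_ofPred_eq, hdiff, hBker] at hi
    exact haI i fun h => hi (hfI i h)
  · rw [hdiff, hBker]

/-- By rank–nullity, each further kernel costs at most the rank of its operator on `W`. -/
theorem finrank_le_finrank_iInf_ker_add_sum {V σ : Type*} [AddCommGroup V] [Module ℂ V]
    (L : σ → V →ₗ[ℂ] V) (W : Submodule ℂ V) [FiniteDimensional ℂ W] (s : Finset σ) :
    Module.finrank ℂ W ≤ Module.finrank ℂ (W ⊓ ⨅ i ∈ s, LinearMap.ker (L i) : Submodule ℂ V) +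
      ∑ i ∈ s, Module.finrank ℂ (W.map (L i)) := by
  classical
  induction s using Finset.induction_on with
  | empty =>
    have h : W ⊓ ⨅ i ∈ (∅ : Finset σ), LinearMap.ker (L i) = W := by simp
    rw [h, Finset.sum_empty, add_zero]
  | insert a s ha ih =>
    have hfd : FiniteDimensional ℂ (W ⊓ ⨅ i ∈ s, LinearMap.ker (L i) : Submodule ℂ V) :=
      Submodule.finiteDimensional_of_le inf_le_left
    have h := finrank_map_add_finrank_inf_ker (L a) (W ⊓ ⨅ i ∈ s, LinearMap.ker (L i))
    have h2 : Module.finrank ℂ ((W ⊓ ⨅ i ∈ s, LinearMap.ker (L i)).map (L a)) ≤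
        Module.finrank ℂ (W.map (L a)) :=
      Submodule.finrank_mono (Submodule.map_mono inf_le_left)
    have h3 : (W ⊓ ⨅ i ∈ insert a s, LinearMap.ker (L i)) =
        W ⊓ (⨅ i ∈ s, LinearMap.ker (L i)) ⊓ LinearMap.ker (L a) := by
      rw [Finset.iInf_insert, inf_comm (LinearMap.ker (L a)), inf_assoc]
    rw [Finset.sum_insert ha, h3]
    omega

theorem IsFacetForm.ker_eq {n : ℕ} {ι : Type*} {X : ι → Fin n → ℝ} {f : (Fin n → ℝ) →ₗ[ℝ] ℝ}
    (hf : IsFacetForm X f) :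
    LinearMap.ker f = Submodule.span ℝ (X '' {i | f (X i) = 0}) := by
  refine le_antisymm hf.2 (Submodule.span_le.mpr ?_)
  rintro _ ⟨i, hi, rfl⟩
  exact hi

/-- The sets `basesThrough` are fibres of `B ↦ span (B ∖ a)` on bases where `a` is active, and `a ∈
I` is never active in an element of `internalBases X I`. -/
theorem ncard_internalBases_add_sum_le {n : ℕ} {ι : Type*} [Finite ι] [LinearOrder ι]
    (X : ι → Fin n → ℝ) {I : Set ι} {a : ι} (ha : a ∈ I)
    (s : Finset (Submodule ℝ (Fin n → ℝ))) :
    (internalBases X I).ncard + ∑ F ∈ s, (basesThrough X (I \ {a}) a F).ncard ≤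
      (internalBases X (I \ {a})).ncard := by
  classical
  have := Fintype.ofFinite ι
  let D : Finset (Set ι) := Finset.univ.filter fun B =>
    B ∈ internalBases X (I \ {a}) ∧ IsInternallyActive X {a} B a
  have h1 : ∀ F, (basesThrough X (I \ {a}) a F).ncard =
      (D.filter fun B => Submodule.span ℝ (X '' (B \ {a})) = F).card := by
    intro F
    rw [← Set.ncard_coe_finset]
    congr 1
    ext B
    simp [D, basesThrough, and_assoc]
  simp only [h1]
  rw [Finset.sum_card_fiberwise_eq_card_filter, ← Set.ncard_coe_finset, ← Set.ncard_union_eq]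
  · refine Set.ncard_le_ncard (Set.union_subset ?_ ?_)
    · exact fun B hB => ⟨hB.1, fun b hb => hB.2 b ⟨hb.1, hb.2.1.1, hb.2.2⟩⟩
    · intro B hB
      simp only [D, Finset.coe_filter, Finset.mem_filter, Finset.mem_univ, true_and] at hB
      exact hB.1.1
  · rw [Set.disjoint_left]
    intro B hB hB2
    simp only [D, Finset.coe_filter, Finset.mem_filter, Finset.mem_univ, true_and] at hB2
    have h := hB2.1.2
    exact hB.2 a ⟨h.1, ha, h.2.2⟩

theorem exists_smul_eq_of_ker_eq {n : ℕ} {f g : (Fin n → ℝ) →ₗ[ℝ] ℝ} {v : Fin n → ℝ}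
    (hg : g v ≠ 0) (h : LinearMap.ker f = LinearMap.ker g) : f = (f v / g v) • g := by
  refine LinearMap.ext fun w => ?_
  have h1 : w - (g w / g v) • v ∈ LinearMap.ker f := by
    rw [h, LinearMap.mem_ker]
    simp [hg]
  rw [LinearMap.mem_ker, map_sub, map_smul, sub_eq_zero] at h1
  rw [h1, LinearMap.smul_apply, smul_eq_mul, smul_eq_mul]
  ring

theorem ncard_internalBases_le_finrank {n : ℕ} {ι : Type*} [Finite ι] [LinearOrder ι]
    (X : ι → Fin n → ℝ) (hX : Submodule.span ℝ (Set.range X) = ⊤) (I : Set ι)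
    (hI : ∀ x, x ∉ I → ∀ y ∈ I, x < y) :
    (internalBases X I).ncard ≤ Module.finrank ℂ (semiInternalSpace X I) := by
  classical
  induction hc : I.ncard generalizing I with
  | zero =>
    obtain rfl : I = ∅ := (Set.ncard_eq_zero).mp hc
    have h : semiInternalSpace X ∅ = centralSpace X := by simp [semiInternalSpace]
    rw [h, internalBases_empty]
    exact ncard_bases_le_finrank X
  | succ c ih =>
    have hne : I.Nonempty := by
      rw [← Set.ncard_pos, hc]
      omega
    -- With `a` first in `I`, the order condition survives its removal, and only elements of `I ∖ a`
    -- come after it.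
    obtain ⟨a, ha, hmin⟩ := Set.exists_min_image I id (Set.toFinite I) hne
    have hlt : ∀ x, x ∉ I \ {a} → x ≤ a := by
      intro x hx
      by_cases hxI : x ∈ I
      · have : x = a := by simpa [hxI] using hx
        exact this.le
      · exact (hI x hxI a ha).le
    have hI' : ∀ x, x ∉ I \ {a} → ∀ y ∈ I \ {a}, x < y := fun x hx y hy =>
      (hlt x hx).trans_lt (lt_of_le_of_ne (hmin y hy.1) (Ne.symm hy.2))
    have hcard : (I \ {a}).ncard = c := by
      have := Set.ncard_sdiff_singleton_add_one ha
      omega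
    have ih' := ih (I \ {a}) hI' hcard
    -- The facets whose exponent drops on passing from `I ∖ a` to `I`; one form is chosen for each,
    -- so that each is counted once.
    let 𝒦 : Set (Submodule ℝ (Fin n → ℝ)) := {F | ∃ f : (Fin n → ℝ) →ₗ[ℝ] ℝ, IsFacetForm X f ∧
      f (X a) ≠ 0 ∧ (∀ i ∈ I \ {a}, f (X i) = 0) ∧ LinearMap.ker f = F}
    have hfin : 𝒦.Finite := by
      refine (Set.finite_range fun Y : Set ι => Submodule.span ℝ (X '' Y)).subset ?_
      rintro _ ⟨f, hf, -, -, rfl⟩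
      exact ⟨_, hf.ker_eq.symm⟩
    let form : Submodule ℝ (Fin n → ℝ) → ((Fin n → ℝ) →ₗ[ℝ] ℝ) := fun F =>
      if h : F ∈ 𝒦 then h.choose else 0
    have hform : ∀ F ∈ 𝒦, IsFacetForm X (form F) ∧ form F (X a) ≠ 0 ∧
        (∀ i ∈ I \ {a}, form F (X i) = 0) ∧ LinearMap.ker (form F) = F := by
      intro F hF
      simp only [form, dif_pos hF]
      exact hF.choose_spec
    have hfd : FiniteDimensional ℂ (semiInternalSpace X (I \ {a})) :=
      Submodule.finiteDimensional_of_le inf_le_left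
    have h1 := finrank_le_finrank_iInf_ker_add_sum
      (fun F => dirDiff (form F) ^ (multOff X (form F) - 1)) (semiInternalSpace X (I \ {a}))
      hfin.toFinset
    have h2 : ∑ F ∈ hfin.toFinset, Module.finrank ℂ ((semiInternalSpace X (I \ {a})).map
        (dirDiff (form F) ^ (multOff X (form F) - 1))) ≤
        ∑ F ∈ hfin.toFinset, (basesThrough X (I \ {a}) a F).ncard := by
      refine Finset.sum_le_sum fun F hF => ?_
      obtain ⟨hf, hfa, hfI, hfF⟩ := hform F (hfin.mem_toFinset.mp hF)
      have := finrank_map_dirDiff_pow_le hI' hlt hf hfa hfI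
      rwa [hfF] at this
    have h3 := ncard_internalBases_add_sum_le X ha hfin.toFinset
    have h4 : semiInternalSpace X (I \ {a}) ⊓ ⨅ F ∈ hfin.toFinset,
        LinearMap.ker (dirDiff (form F) ^ (multOff X (form F) - 1)) ≤ semiInternalSpace X I := by
      rintro q ⟨hq1, hq2⟩
      rw [semiInternalSpace_eq_facetKer X hX] at hq1 ⊢
      simp only [SetLike.mem_coe, Submodule.mem_iInf, Set.Finite.mem_toFinset,
        LinearMap.mem_ker] at hq2
      rw [SetLike.mem_coe, mem_facetKer] at hq1
      rw [mem_facetKer]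
      intro f hf
      by_cases h : ∃ i ∈ I, f (X i) ≠ 0
      · by_cases h' : ∃ i ∈ I \ {a}, f (X i) ≠ 0
        · have := hq1 f hf
          rw [facetExponent, if_pos h'] at this
          rwa [facetExponent, if_pos h]
        · push Not at h'
          have hfa : f (X a) ≠ 0 := by
            obtain ⟨i, hi, hi2⟩ := h
            by_cases hia : i = a
            · exact hia ▸ hi2
            · exact absurd (h' i ⟨hi, hia⟩) hi2
          have hF : LinearMap.ker f ∈ 𝒦 := ⟨f, hf, hfa, h', rfl⟩
          obtain ⟨-, hga, -, hgker⟩ := hform _ hF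
          have hmult : multOff X (form (LinearMap.ker f)) = multOff X f := by
            rw [multOff, multOff]
            congr 1
            ext i
            simp only [Set.mem_ofPred_eq, ← LinearMap.mem_ker, ne_eq, hgker]
          have hq := hq2 _ hF
          rw [hmult] at hq
          -- `f` is a multiple of the form chosen for its kernel, so the chosen form's condition
          -- suffices.
          rw [facetExponent, if_pos h, exists_smul_eq_of_ker_eq hga hgker.symm, dirDiff_smul,
            smul_pow, LinearMap.smul_apply, ← exists_smul_eq_of_ker_eq hga hgker.symm, hq,
            smul_zero]
      · have h' : ¬ ∃ i ∈ I \ {a}, f (X i) ≠ 0 := fun ⟨i, hi, hi2⟩ => h ⟨i, hi.1, hi2⟩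
        have := hq1 f hf
        rw [facetExponent, if_neg h'] at this
        rwa [facetExponent, if_neg h]
    have hfd' : FiniteDimensional ℂ (semiInternalSpace X I) :=
      Submodule.finiteDimensional_of_le inf_le_left
    have h5 := Submodule.finrank_mono h4
    omega

/-- The exponents depend on `I` only through whether `span I ⊆ ker f`. -/
theorem facetKer_congr_of_span_eq {n : ℕ} {ι : Type*} (X : ι → Fin n → ℝ) {I J : Set ι}
    (h : Submodule.span ℝ (X '' I) = Submodule.span ℝ (X '' J)) : facetKer X I = facetKer X J := by
  have key : ∀ (K : Set ι) (f : (Fin n → ℝ) →ₗ[ℝ] ℝ),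
      (∃ i ∈ K, f (X i) ≠ 0) ↔ ¬ Submodule.span ℝ (X '' K) ≤ LinearMap.ker f := by
    intro K f
    rw [Submodule.span_le, Set.image_subset_iff, Set.not_subset]
    rfl
  have hexp : ∀ f, facetExponent X I f = facetExponent X J f := by
    intro f
    classical
    rw [facetExponent, facetExponent]
    congr 1
    exact if_congr (by rw [key, key, h]) rfl rfl
  ext q
  simp only [mem_facetKer, hexp]

/-! ### Differential operators and kernels of ideals -/

/-- The commutator of two derivations is a derivation, and this one vanishes on the variables. -/
theorem pderiv_comm {n : ℕ} (i j : Fin n) :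
    ((pderiv i).toLinearMap : Module.End ℂ (MvPolynomial (Fin n) ℂ)) * (pderiv j).toLinearMap =
      (pderiv j).toLinearMap * (pderiv i).toLinearMap := by
  have h : ⁅pderiv (R := ℂ) i, pderiv (R := ℂ) j⁆ = 0 := by
    refine MvPolynomial.derivation_ext (R := ℂ) fun k => ?_
    rw [Derivation.commutator_apply, pderiv_X, pderiv_X]
    simp [Pi.single_apply, apply_ite]
  refine LinearMap.ext fun q => ?_
  have := DFunLike.congr_fun h q
  rw [Derivation.commutator_apply, Derivation.zero_apply, sub_eq_zero] at this
  exact this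

/-- The assignment `p ↦ p(D)` is multiplicative. -/
theorem exists_algHom_eq_polyDiff (n : ℕ) :
    ∃ Φ : MvPolynomial (Fin n) ℂ →ₐ[ℂ] Module.End ℂ (MvPolynomial (Fin n) ℂ),
      (∀ p, Φ p = polyDiff p) ∧ ∀ j, Φ (X j) = (pderiv j).toLinearMap := by
  let P : Fin n → Module.End ℂ (MvPolynomial (Fin n) ℂ) := fun j => (pderiv j).toLinearMap
  have hc : ∀ a ∈ Set.range P, ∀ b ∈ Set.range P, a * b = b * a := by
    rintro _ ⟨i, rfl⟩ _ ⟨j, rfl⟩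
    exact pderiv_comm i j
  -- Evaluation of polynomials needs a commutative target: the subalgebra generated by the partial
  -- derivatives.
  have := Algebra.isMulCommutative_adjoin ℂ hc
  open scoped IsMulCommutative in
  let Q : Fin n → Algebra.adjoin ℂ (Set.range P) := fun j =>
    ⟨P j, Algebra.subset_adjoin ⟨j, rfl⟩⟩
  open scoped IsMulCommutative in
  refine ⟨(Algebra.adjoin ℂ (Set.range P)).val.comp (aeval Q), fun p => ?_, fun j => ?_⟩
  · rw [AlgHom.comp_apply, aeval_def, eval₂_eq', map_sum, polyDiff]
    refine Finset.sum_congr rfl fun m _ => ?_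
    rw [← Algebra.smul_def, map_smul, monomialDiff, ← List.prod_ofFn, map_list_prod, List.map_ofFn]
    rfl
  · rw [AlgHom.comp_apply, aeval_X]
    rfl

theorem polyDiff_mul {n : ℕ} (p q : MvPolynomial (Fin n) ℂ) :
    polyDiff (p * q) = polyDiff p * polyDiff q := by
  obtain ⟨Φ, hΦ, -⟩ := exists_algHom_eq_polyDiff n
  rw [← hΦ, ← hΦ, ← hΦ, map_mul]

theorem polyDiff_add {n : ℕ} (p q : MvPolynomial (Fin n) ℂ) :
    polyDiff (p + q) = polyDiff p + polyDiff q := by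
  obtain ⟨Φ, hΦ, -⟩ := exists_algHom_eq_polyDiff n
  rw [← hΦ, ← hΦ, ← hΦ, map_add]

theorem polyDiff_linForm_pow {n : ℕ} (η : Fin n → ℝ) (m : ℕ) :
    polyDiff (linForm η ^ m) = dirDiff (dotProductEquiv ℝ (Fin n) η) ^ m := by
  obtain ⟨Φ, hΦ, hX⟩ := exists_algHom_eq_polyDiff n
  rw [← hΦ, map_pow]
  congr 1
  have hsum : ∀ q : MvPolynomial (Fin n) ℂ, (∑ j, (η j : ℂ) • pderiv j : Derivation ℂ _ _) q =
      ∑ j, (η j : ℂ) • pderiv j q := by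
    intro q
    have := congrFun (map_sum (Derivation.coeFnAddMonoidHom (R := ℂ)
      (A := MvPolynomial (Fin n) ℂ) (M := MvPolynomial (Fin n) ℂ))
      (fun j => (η j : ℂ) • pderiv j) Finset.univ) q
    rw [Finset.sum_apply] at this
    exact this
  have h : (mkDerivation ℂ fun j => C (dotProductEquiv ℝ (Fin n) η (Pi.single j 1) : ℂ) :
      Derivation ℂ (MvPolynomial (Fin n) ℂ) (MvPolynomial (Fin n) ℂ)) =
      ∑ j, (η j : ℂ) • pderiv j := by
    refine MvPolynomial.derivation_ext fun i => ?_
    rw [mkDerivation_X, hsum, Finset.sum_eq_single i]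
    · simp [smul_eq_C_mul]
    · intro j _ hj
      simp [pderiv_X, hj.symm]
    · simp
  rw [dirDiff, h, linForm, map_sum]
  refine LinearMap.ext fun q => ?_
  simp only [← smul_eq_C_mul, map_smul, hX, LinearMap.sum_apply, LinearMap.smul_apply]
  exact (hsum q).symm

/-- As `p ↦ p(D)` is a ring homomorphism, the `p` with `p(D) q = 0` form an ideal, so generators
suffice. -/
theorem mem_idealKer_span {n : ℕ} {S : Set (MvPolynomial (Fin n) ℂ)}
    {q : MvPolynomial (Fin n) ℂ} :
    q ∈ idealKer (Ideal.span S) ↔ ∀ p ∈ S, polyDiff p q = 0 := by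
  refine ⟨fun h p hp => h p (Ideal.subset_span hp), fun h p hp => ?_⟩
  induction hp using Submodule.span_induction with
  | mem p hp => exact h p hp
  | zero => simp [polyDiff]
  | add a b _ _ ha hb => rw [polyDiff_add, LinearMap.add_apply, ha, hb, add_zero]
  | smul a b _ hb => rw [smul_eq_mul, polyDiff_mul, Module.End.mul_apply, hb, map_zero]

theorem finrank_ker_add_one {n : ℕ} {f : (Fin n → ℝ) →ₗ[ℝ] ℝ} (hf : f ≠ 0) :
    Module.finrank ℝ (LinearMap.ker f) + 1 = n := by
  have := Module.Dual.finrank_ker_add_one_of_ne_zero (f := f) hf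
  rwa [Module.finrank_fin_fun] at this

theorem IsFacet.ker_eq {n : ℕ} {ι : Type*} {X : ι → Fin n → ℝ} {F : Submodule ℝ (Fin n → ℝ)}
    (hF : IsFacet X F) {η : Fin n → ℝ} (hη : IsNormalTo η F) :
    F = LinearMap.ker (dotProductEquiv ℝ (Fin n) η) ∧
      IsFacetForm X (dotProductEquiv ℝ (Fin n) η) := by
  have hne : dotProductEquiv ℝ (Fin n) η ≠ 0 := by
    simpa using hη.1
  have hle : F ≤ LinearMap.ker (dotProductEquiv ℝ (Fin n) η) := fun v hv => hη.2 v hv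
  have heq : F = LinearMap.ker (dotProductEquiv ℝ (Fin n) η) := by
    refine Submodule.eq_of_le_of_finrank_eq hle ?_
    have h1 := finrank_ker_add_one hne
    have h2 := hF.1
    omega
  refine ⟨heq, hne, ?_⟩
  obtain ⟨Y, hY⟩ := hF.2
  rw [← heq]
  conv_lhs => rw [← hY]
  refine Submodule.span_mono (Set.image_mono fun i hi => ?_)
  have : X i ∈ F := hY ▸ Submodule.subset_span ⟨i, hi, rfl⟩
  exact hle this

theorem facetKer_eq_idealKer {n : ℕ} {ι : Type*} (X : ι → Fin n → ℝ) (I : Set ι) :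
    facetKer X I = idealKer (semiInternalIdeal X I) := by
  ext q
  rw [mem_facetKer, semiInternalIdeal, mem_idealKer_span]
  constructor
  · rintro h p (hp | ⟨F, η, hF, hIF, hη, rfl⟩)
    · refine mem_idealKer_span.mpr ?_ p hp
      rintro _ ⟨F, η, hF, hη, rfl⟩
      obtain ⟨hker, hf⟩ := hF.ker_eq hη
      rw [polyDiff_linForm_pow]
      have := h _ hf
      rw [hker]
      -- Generators of the central ideal carry the full exponent `m(F)`, which is at least
      -- `facetExponent`.
      exact dirDiff_pow_eq_zero_of_le (Nat.sub_le _ _) this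
    · obtain ⟨hker, hf⟩ := hF.ker_eq hη
      rw [polyDiff_linForm_pow]
      have := h _ hf
      have hIF : ∃ i ∈ I, dotProductEquiv ℝ (Fin n) η (X i) ≠ 0 := by
        rwa [hker, Set.image_subset_iff, Set.not_subset] at hIF
      rw [facetExponent, if_pos hIF] at this
      rw [hker]
      exact this
  · intro h f hf
    obtain ⟨η, rfl⟩ := (dotProductEquiv ℝ (Fin n)).surjective f
    have hF : IsFacet X (LinearMap.ker (dotProductEquiv ℝ (Fin n) η)) :=
      ⟨finrank_ker_add_one hf.1, _, hf.ker_eq.symm⟩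
    have hη : IsNormalTo η (LinearMap.ker (dotProductEquiv ℝ (Fin n) η)) := by
      refine ⟨?_, fun v hv => hv⟩
      rintro rfl
      exact hf.1 (map_zero _)
    by_cases hI : ∃ i ∈ I, dotProductEquiv ℝ (Fin n) η (X i) ≠ 0
    · have := h _ (Or.inr ⟨_, η, hF, by rwa [Set.image_subset_iff, Set.not_subset], hη, rfl⟩)
      rw [polyDiff_linForm_pow] at this
      rw [facetExponent, if_pos hI]
      exact this
    · have := h _ (Or.inl (Ideal.subset_span ⟨_, η, hF, hη, rfl⟩))
      rw [polyDiff_linForm_pow] at this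
      rw [facetExponent, if_neg hI]
      exact this

end Zonotopal

theorem theorem3p4 {n : ℕ} {ι : Type*} [Finite ι] [LinearOrder ι] (X : ι → Fin n → ℝ)
    (hX0 : ∀ i, X i ≠ 0) (hX : Submodule.span ℝ (Set.range X) = ⊤)
    (I : Set ι) (hI : LinearIndepOn ℝ X I) :
    ((∀ x, x ∉ I → ∀ y ∈ I, x < y) →
      FiniteDimensional ℂ (Zonotopal.semiInternalSpace X I) ∧
      Module.finrank ℂ (Zonotopal.semiInternalSpace X I) =
        (Zonotopal.internalBases X I).ncard) ∧
    Zonotopal.semiInternalSpace X I = Zonotopal.idealKer (Zonotopal.semiInternalIdeal X I) ∧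
    ∀ I' : Set ι, LinearIndepOn ℝ X I' →
      Submodule.span ℝ (X '' I') = Submodule.span ℝ (X '' I) →
      Zonotopal.semiInternalSpace X I' = Zonotopal.semiInternalSpace X I := by
  have hK := Zonotopal.semiInternalSpace_eq_facetKer X hX
  refine ⟨fun hord => ?_, ?_, fun I' _ hspan => ?_⟩
  · obtain ⟨hfd, hle⟩ := Zonotopal.finrank_facetKer_le X hX I hord
    rw [← hK] at hfd hle
    exact ⟨hfd, le_antisymm hle (Zonotopal.ncard_internalBases_le_finrank X hX I hord)⟩
  · rw [hK, Zonotopal.facetKer_eq_idealKer]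
  · rw [hK, hK, Zonotopal.facetKer_congr_of_span_eq X hspan]
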